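/- **Conventions.** For a semigroup $S$, let $a\,\mathcal R^*\,b$ mean that for all $x,y\in S^1$, $xa=ya\iff xb=yb$; $\mathcal L^*$ is dual; $\mathcal L,\mathcal R$ are Green's relations. $S$ is *abundant* if every $\mathcal R^*$-class and every $\mathcal L^*$-class contains an idempotent; *adequate* if moreover its idempotents commute; *quasi-adequate* if it is abundant and its idempotents form a subsemigroup. In an adequate semigroup, $a^+$ (resp. $a^*$) is the unique idempotent in the $\mathcal R^*$-class (resp. $\mathcal L^*$-class) of $a$. Let $S^0$ be an adequate subsemigroup of an abundant semigroup $S$ whose relations $\mathcal L^*,\mathcal R^*$ are the restrictions of those of $S$. Then $S^0$ is an *adequate transversal* of $S$ if for every $x\in S$ there is a unique $\bar x\in S^0$ for which there are idempotents $e,f$ of $S$ with $x=e\bar xf$, $e\,\mathcal L\,\bar x^+$, $f\,\mathcal R\,\bar x^*$. These $e,f$ are then unique, and are denoted $e_x,f_x$; put $I(S)=\{e_x:x\in S\}$, $\Lambda(S)=\{f_x:x\in S\}$. The transversal is *admissible* if $\overline{xy}=\bar x\,\bar y$ for all $x,y\in S$. A band is *left regular* if $aba=ab$, and *right regular* if $aba=ba$,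 for all $a,b$. A subsemilattice $E^0$ of a band $B$ is a *semilattice transversal* of $B$ if every $b\in B$ has exactly one inverse $b^0$ in $E^0$. **Theorem.** Let $S^0$ be an adequate semigroup with semilattice of idempotents $E^0$, and let $I$ be a left regular band and $\Lambda$ a right regular band with $E^0$ (embedded in each of them) as a common semilattice transversal. For $p\in E^0$ let $L_p$ be the $\mathcal L$-class of $p$ in $I$ and $R_p$ the $\mathcal R$-class of $p$ in $\Lambda$. Suppose that for all $x,y\in S^0$ there are maps $\alpha_{x,y}:R_{x^*}\times L_{y^+}\to L_{(xy)^+}$ and $\beta_{x,y}:R_{x^*}\times L_{y^+}\to R_{(xy)^*}$, written on the right, such that: 1. for $x,y,z\in S^0$, $f\in R_{x^*}$, $g\in L_{y^+}$, $h\in R_{y^*}$, $k\in L_{z^+}$: $$(f,g)\alpha_{x,y}\,\big((f,g)\beta_{x,y}h,\,k\big)\alpha_{xy,z}=\big(f,\,g(h,k)\alpha_{y,z}\big)\alpha_{x,yz},$$ $$\big(f,\,g(h,k)\alpha_{y,z}\big)\beta_{x,yz}\,(h,k)\beta_{y,z}=\big((f,g)\beta_{x,y}h,\,k\big)\beta_{xy,z};$$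 2. for $x,y\in S^0$: $(x^*,y^+)\alpha_{x,y}=(xy)^+$ and $(x^*,y^+)\beta_{x,y}=(xy)^*$; 3. for $x,x_1,x_2\in S^0$, $e_i\in L_{x_i^+}$, $f_i\in R_{x_i^*}$ ($i=1,2$), $e\in L_{x^+}$: if $e_1(f_1,e)\alpha_{x_1,x}=e_2(f_2,e)\alpha_{x_2,x}$, $x_1x=x_2x$ and $(f_1,e)\beta_{x_1,x}x^*=(f_2,e)\beta_{x_2,x}x^*$, then $e_1(f_1,e)\alpha_{x_1,x^+}=e_2(f_2,e)\alpha_{x_2,x^+}$, $x_1x^+=x_2x^+$ and $(f_1,e)\beta_{x_1,x^+}=(f_2,e)\beta_{x_2,x^+}$; 4. for $x,x_1,x_2\in S^0$, $e_i\in L_{x_i^+}$, $f_i\in R_{x_i^*}$ ($i=1,2$), $f\in R_{x^*}$: if $x^+(f,e_1)\alpha_{x,x_1}=x^+(f,e_2)\alpha_{x,x_2}$, $xx_1=xx_2$ and $(f,e_1)\beta_{x,x_1}f_1=(f,e_2)\beta_{x,x_2}f_2$, then $(f,e_1)\alpha_{x^*,x_1}=(f,e_2)\alpha_{x^*,x_2}$,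 $x^*x_1=x^*x_2$ and $(f,e_1)\beta_{x^*,x_1}f_1=(f,e_2)\beta_{x^*,x_2}f_2$. Let $W=\{(e,x,f)\in I\times S^0\times\Lambda: e\in L_{x^+},\ f\in R_{x^*}\}$ with the multiplication $$(e,x,f)(g,y,h)=\big(e\,(f,g)\alpha_{x,y},\;xy,\;(f,g)\beta_{x,y}\,h\big).$$ Then $W$ is closed under this multiplication and is a quasi-adequate semigroup, and $W^0=\{(x^+,x,x^*):x\in S^0\}$ is an admissible adequate transversal of $W$, isomorphic to $S^0$ via $x\mapsto(x^+,x,x^*)$. If in addition 5. for all $f\in\Lambda$, $e\in I$: $(f^0,e)\alpha_{f^0,e^0}=f^0e$ and $(f,e^0)\beta_{f^0,e^0}=fe^0$, then, with respect to $W^0$, $I(W)$ and $\Lambda(W)$ are subsemigroups of $W$, with $I(W)\cong I$ and $\Lambda(W)\cong\Lambda$. Conversely, let $S$ be a quasi-adequate semigroup with an admissible adequate transversal $S^0$. Then $I=I(S)$ and $\Lambda=\Lambda(S)$ are subsemigroups of $S$, a left regular and a right regular band with common semilattice transversal $E^0$ (the idempotents of $S^0$), and there are maps $\alpha_{x,y},\beta_{x,y}$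 as above satisfying (1)–(5) such that $x\mapsto(e_x,\bar x,f_x)$ is an isomorphism of $S$ onto the resulting semigroup $W$; it sends each $s\in S^0$ to $(s^+,s,s^*)$. -/

import Mathlib

namespace AdequateTransversal

section Green

variable {S : Type*} [Semigroup S]

/-- `a ℛ* b`: for all `x, y ∈ S¹`, `x a = y a` iff `x b = y b`. -/
def RStar (a b : S) : Prop :=
  ∀ x y : WithOne S,
    x * (a : WithOne S) = y * (a : WithOne S) ↔ x * (b : WithOne S) = y * (b : WithOne S)

/-- `a ℒ* b`: for all `x, y ∈ S¹`, `a x = a y` iff `b x = b y`. -/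
def LStar (a b : S) : Prop :=
  ∀ x y : WithOne S,
    (a : WithOne S) * x = (a : WithOne S) * y ↔ (b : WithOne S) * x = (b : WithOne S) * y

/-- Green's relation `ℒ`: `S¹ a = S¹ b`. -/
def GreenL (a b : S) : Prop :=
  (∃ u : WithOne S, u * (a : WithOne S) = b) ∧ ∃ v : WithOne S, v * (b : WithOne S) = a

/-- Green's relation `ℛ`: `a S¹ = b S¹`. -/
def GreenR (a b : S) : Prop :=
  (∃ u : WithOne S, (a : WithOne S) * u = b) ∧ ∃ v : WithOne S, (b : WithOne S) * v = a

/-- `b ∈ V(a)`: `b` is an inverse of `a`. -/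
def IsInverse (a b : S) : Prop := a * b * a = a ∧ b * a * b = b

end Green

section Classes

variable (S : Type*) [Semigroup S]

/-- Every `ℛ*`-class and every `ℒ*`-class contains an idempotent. -/
structure IsAbundant : Prop where
  exists_plus : ∀ a : S, ∃ e : S, IsIdempotentElem e ∧ RStar e a
  exists_ast : ∀ a : S, ∃ f : S, IsIdempotentElem f ∧ LStar f a

/-- Abundant with commuting idempotents. -/
structure IsAdequate : Prop extends IsAbundant S where
  comm : ∀ e f : S, IsIdempotentElem e → IsIdempotentElem f → e * f = f * e

/-- Abundant, with idempotents forming a subsemigroup. -/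
structure IsQuasiAdequate : Prop extends IsAbundant S where
  mul_idem : ∀ e f : S, IsIdempotentElem e → IsIdempotentElem f → IsIdempotentElem (e * f)

/-- A left regular band: all elements are idempotent and `a b a = a b`. -/
structure IsLeftRegularBand : Prop where
  idem : ∀ a : S, a * a = a
  left_regular : ∀ a b : S, a * b * a = a * b

/-- A right regular band: all elements are idempotent and `a b a = b a`. -/
structure IsRightRegularBand : Prop where
  idem : ∀ a : S, a * a = a
  right_regular : ∀ a b : S, a * b * a = b * a

end Classes

namespace IsAdequate

variable {S : Type*} [Semigroup S] (h : IsAdequate S)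

/-- The semilattice of idempotents of an adequate semigroup. -/
def idem : Subsemigroup S where
  carrier := {e | IsIdempotentElem e}
  mul_mem' := by
    intro a b ha hb
    have hc := h.comm a b ha hb
    change a * b * (a * b) = a * b
    calc a * b * (a * b) = a * (b * a) * b := by simp only [mul_assoc]
      _ = a * (a * b) * b := by rw [hc]
      _ = (a * a) * (b * b) := by simp only [mul_assoc]
      _ = a * b := by rw [ha.eq, hb.eq]

/-- `a⁺`: the idempotent in the `ℛ*`-class of `a`. -/
noncomputable def plus (a : S) : h.idem :=
  ⟨(h.exists_plus a).choose, (h.exists_plus a).choose_spec.1⟩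

/-- `a*`: the idempotent in the `ℒ*`-class of `a`. -/
noncomputable def ast (a : S) : h.idem :=
  ⟨(h.exists_ast a).choose, (h.exists_ast a).choose_spec.1⟩

theorem plus_rel (a : S) : RStar (h.plus a : S) a := (h.exists_plus a).choose_spec.2

theorem ast_rel (a : S) : LStar (h.ast a : S) a := (h.exists_ast a).choose_spec.2

/-- `a⁺` is the only idempotent in the `ℛ*`-class of `a`. -/
theorem eq_plus {a e : S} (he : IsIdempotentElem e) (hea : RStar e a) : e = h.plus a := by
  have hp : IsIdempotentElem (h.plus a : S) := (h.plus a).2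
  have key : RStar e (h.plus a : S) := fun x y => (hea x y).trans (h.plus_rel a x y).symm
  have h1 := (key (e : WithOne S) 1).1 (by
    rw [one_mul, ← WithOne.coe_mul, he.eq])
  have h2 := (key ((h.plus a : S) : WithOne S) 1).2 (by
    rw [one_mul, ← WithOne.coe_mul, hp.eq])
  rw [one_mul, ← WithOne.coe_mul, WithOne.coe_inj] at h1 h2
  rw [← h2, h.comm _ _ hp he, h1]

/-- `a*` is the only idempotent in the `ℒ*`-class of `a`. -/
theorem eq_ast {a e : S} (he : IsIdempotentElem e) (hea : LStar e a) : e = h.ast a := by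
  have hp : IsIdempotentElem (h.ast a : S) := (h.ast a).2
  have key : LStar e (h.ast a : S) := fun x y => (hea x y).trans (h.ast_rel a x y).symm
  have h1 := (key (e : WithOne S) 1).1 (by
    rw [mul_one, ← WithOne.coe_mul, he.eq])
  have h2 := (key ((h.ast a : S) : WithOne S) 1).2 (by
    rw [mul_one, ← WithOne.coe_mul, hp.eq])
  rw [mul_one, ← WithOne.coe_mul, WithOne.coe_inj] at h1 h2
  rw [← h2, h.comm _ _ he hp, h1]

end IsAdequate

section Transversal

variable {S : Type*} [Semigroup S]

/-- An abundant subsemigroup `U` of `S` whose relations `ℒ*`, `ℛ*` are the restrictions of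
those of `S`. -/
structure IsStarSubsemigroup (U : Subsemigroup S) : Prop where
  abundant : IsAbundant U
  lstar_iff : ∀ a b : U, LStar a b ↔ LStar (a : S) (b : S)
  rstar_iff : ∀ a b : U, RStar a b ↔ RStar (a : S) (b : S)

/-- `x = e x̄ f` with `e, f` idempotents of `S`, `x̄ ∈ S⁰`, `e ℒ x̄⁺` and `f ℛ x̄*`. -/
structure Decomposes {S0 : Subsemigroup S} (h : IsAdequate S0) (x e : S) (xbar : S0) (f : S) :
    Prop where
  idem_left : IsIdempotentElem e
  idem_right : IsIdempotentElem f
  eq : x = e * (xbar : S) * f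
  left : GreenL e ((h.plus xbar : S0) : S)
  right : GreenR f ((h.ast xbar : S0) : S)

/-- `S⁰` is an adequate transversal of the abundant semigroup `S`. -/
structure IsAdequateTransversal (S0 : Subsemigroup S) : Prop where
  abundant : IsAbundant S
  adequate : IsAdequate S0
  starSub : IsStarSubsemigroup S0
  existsUnique_bar : ∀ x : S, ∃! xbar : S0, ∃ e f : S, Decomposes adequate x e xbar f

namespace IsAdequateTransversal

variable {S0 : Subsemigroup S} (h : IsAdequateTransversal S0)

/-- The element `x̄ ∈ S⁰` attached to `x ∈ S`. -/
noncomputable def bar (x : S) : S0 := (h.existsUnique_bar x).choose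

/-- The transversal is admissible if `x ↦ x̄` is multiplicative. -/
def Admissible : Prop := ∀ x y : S, h.bar (x * y) = h.bar x * h.bar y

/-- `I(S)`, the set of all left factors `e_x`. -/
def leftFactors : Set S := {e | ∃ (x : S) (f : S), Decomposes h.adequate x e (h.bar x) f}

/-- `Λ(S)`, the set of all right factors `f_x`. -/
def rightFactors : Set S := {f | ∃ (x : S) (e : S), Decomposes h.adequate x e (h.bar x) f}

end IsAdequateTransversal

/-- For a semilattice `E` and an embedding `i` of `E` in `B`: each element of `B` has exactly one
inverse in `E`. -/
structure IsSemilatticeTransversal {E B : Type*} [Semigroup E] [Semigroup B] (i : E →ₙ* B) :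
    Prop where
  injective : Function.Injective i
  existsUnique_inverse : ∀ b : B, ∃! p : E, IsInverse b (i p)

/-- `b⁰`, the unique inverse of `b` in the semilattice transversal. -/
noncomputable def IsSemilatticeTransversal.zero {E B : Type*} [Semigroup E] [Semigroup B]
    {i : E →ₙ* B} (h : IsSemilatticeTransversal i) (b : B) : E :=
  (h.existsUnique_inverse b).choose

end Transversal

/-- A left regular band `I` and a right regular band `Λ` with common semilattice transversal the
semilattice `E⁰` of idempotents of the adequate semigroup `S⁰`, with mappings
`α x y : R_{x*} × L_{y⁺} → L_{(xy)⁺}` and `β x y : R_{x*} × L_{y⁺} → R_{(xy)*}`.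
The values of `α x y` and `β x y` off `R_{x*} × L_{y⁺}` are irrelevant. -/
structure TwistedData {S0 : Type*} [Semigroup S0] (h : IsAdequate S0) (I Λ : Type*)
    [Semigroup I] [Semigroup Λ] where
  leftRegular : IsLeftRegularBand I
  rightRegular : IsRightRegularBand Λ
  toI : h.idem →ₙ* I
  toΛ : h.idem →ₙ* Λ
  transI : IsSemilatticeTransversal toI
  transΛ : IsSemilatticeTransversal toΛ
  α : S0 → S0 → Λ → I → I
  β : S0 → S0 → Λ → I → Λ
  α_mem : ∀ (x y : S0) (f : Λ) (g : I), GreenR f (toΛ (h.ast x)) → GreenL g (toI (h.plus y)) →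
    GreenL (α x y f g) (toI (h.plus (x * y)))
  β_mem : ∀ (x y : S0) (f : Λ) (g : I), GreenR f (toΛ (h.ast x)) → GreenL g (toI (h.plus y)) →
    GreenR (β x y f g) (toΛ (h.ast (x * y)))

namespace TwistedData

variable {S0 : Type*} [Semigroup S0] {h : IsAdequate S0} {I Λ : Type*}
  [Semigroup I] [Semigroup Λ] (D : TwistedData h I Λ)

/-- The `ℒ`-class `L_p` of `p ∈ E⁰` in `I`. -/
def Lcl (p : h.idem) : Set I := {e | GreenL e (D.toI p)}

/-- The `ℛ`-class `R_p` of `p ∈ E⁰` in `Λ`. -/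
def Rcl (p : h.idem) : Set Λ := {f | GreenR f (D.toΛ p)}

/-- Condition (1). -/
def Cond1 : Prop :=
  ∀ (x y z : S0), ∀ f ∈ D.Rcl (h.ast x), ∀ g ∈ D.Lcl (h.plus y),
    ∀ k ∈ D.Rcl (h.ast y), ∀ l ∈ D.Lcl (h.plus z),
      D.α x y f g * D.α (x * y) z (D.β x y f g * k) l = D.α x (y * z) f (g * D.α y z k l) ∧
      D.β x (y * z) f (g * D.α y z k l) * D.β y z k l = D.β (x * y) z (D.β x y f g * k) l

/-- Condition (2). -/
def Cond2 : Prop :=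
  ∀ x y : S0,
    D.α x y (D.toΛ (h.ast x)) (D.toI (h.plus y)) = D.toI (h.plus (x * y)) ∧
    D.β x y (D.toΛ (h.ast x)) (D.toI (h.plus y)) = D.toΛ (h.ast (x * y))

/-- Condition (3). -/
def Cond3 : Prop :=
  ∀ (x x₁ x₂ : S0), ∀ e₁ ∈ D.Lcl (h.plus x₁), ∀ f₁ ∈ D.Rcl (h.ast x₁),
    ∀ e₂ ∈ D.Lcl (h.plus x₂), ∀ f₂ ∈ D.Rcl (h.ast x₂), ∀ e ∈ D.Lcl (h.plus x),
      e₁ * D.α x₁ x f₁ e = e₂ * D.α x₂ x f₂ e → x₁ * x = x₂ * x →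
      D.β x₁ x f₁ e * D.toΛ (h.ast x) = D.β x₂ x f₂ e * D.toΛ (h.ast x) →
      e₁ * D.α x₁ (h.plus x) f₁ e = e₂ * D.α x₂ (h.plus x) f₂ e ∧
      x₁ * (h.plus x : S0) = x₂ * (h.plus x : S0) ∧
      D.β x₁ (h.plus x) f₁ e = D.β x₂ (h.plus x) f₂ e

/-- Condition (4). -/
def Cond4 : Prop :=
  ∀ (x x₁ x₂ : S0), ∀ e₁ ∈ D.Lcl (h.plus x₁), ∀ f₁ ∈ D.Rcl (h.ast x₁),
    ∀ e₂ ∈ D.Lcl (h.plus x₂), ∀ f₂ ∈ D.Rcl (h.ast x₂), ∀ f ∈ D.Rcl (h.ast x),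
      D.toI (h.plus x) * D.α x x₁ f e₁ = D.toI (h.plus x) * D.α x x₂ f e₂ → x * x₁ = x * x₂ →
      D.β x x₁ f e₁ * f₁ = D.β x x₂ f e₂ * f₂ →
      D.α (h.ast x) x₁ f e₁ = D.α (h.ast x) x₂ f e₂ ∧
      (h.ast x : S0) * x₁ = (h.ast x : S0) * x₂ ∧
      D.β (h.ast x) x₁ f e₁ * f₁ = D.β (h.ast x) x₂ f e₂ * f₂

/-- Condition (5). -/
def Cond5 : Prop :=
  ∀ (f : Λ) (e : I),
    D.α (D.transΛ.zero f) (D.transI.zero e) (D.toΛ (D.transΛ.zero f)) e =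
      D.toI (D.transΛ.zero f) * e ∧
    D.β (D.transΛ.zero f) (D.transI.zero e) f (D.toI (D.transI.zero e)) =
      f * D.toΛ (D.transI.zero e)

/-- `W = {(e, x, f) ∈ I × S⁰ × Λ : e ∈ L_{x⁺}, f ∈ R_{x*}}`. -/
@[ext]
structure W where
  e : I
  x : S0
  f : Λ
  e_mem : e ∈ D.Lcl (h.plus x)
  f_mem : f ∈ D.Rcl (h.ast x)

/-- The multiplication of `W` is
`(e, x, f)(g, y, k) = (e (f, g)α_{x,y}, x y, (f, g)β_{x,y} k)`. -/
def IsTwistedMul [Mul D.W] : Prop :=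
  ∀ a b : D.W,
    (a * b).e = a.e * D.α a.x b.x a.f b.e ∧
    (a * b).x = a.x * b.x ∧
    (a * b).f = D.β a.x b.x a.f b.e * b.f

/-- The element `(x⁺, x, x*)` of `W`. -/
noncomputable def diag (x : S0) : D.W where
  e := D.toI (h.plus x)
  x := x
  f := D.toΛ (h.ast x)
  e_mem := ⟨⟨1, one_mul _⟩, ⟨1, one_mul _⟩⟩
  f_mem := ⟨⟨1, mul_one _⟩, ⟨1, mul_one _⟩⟩

end TwistedData

end AdequateTransversal

/-! Direct half. The multiplication of `W` forgets most of `α` and `β`: if `(xy)⁺ = x⁺`, then `(f,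
g)α` lies in the `ℒ`-class of `x⁺`, so multiplying `e = e x⁺` by it returns `e`; dually on the right
when `(xy)* = y*`. These two absorption rules (`mul_e_of_plus`, `mul_f_of_ast`) show that a triple
is idempotent exactly when its middle entry is, so idempotents are closed under products because
those of `S⁰` are. They also give `w = (e, x⁺, x⁺)(x⁺, x, x*)(x*, x*, f)`. The remaining conditions
each have one task: (1) is associativity, (2) makes the diagonal map multiplicative, (3) and (4)
place `(e, x⁺, x⁺)` and `(x*, x*, f)` in the `ℛ*`- and `ℒ*`-class of `w`, and (5) makes the outer
projections multiply as in `I` and `Λ`. Middle entries multiply as in `S⁰`, whence admissibility.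

Converse half. A decomposition `x = e x̄ f` is unique in all three terms (`decomposes_unique`), by
cancelling `x̄` through `ℛ*` and `ℒ*`. For `f ℛ x*` and `g ℒ y⁺`, admissibility gives `x f g y` the
middle term `xy`; its outer terms are taken as `(f, g)α` and `(f, g)β`. Outer idempotents can be
multiplied into a decomposition without changing its middle term (`mul_left`, `mul_right`), so `(e x
f)(g y k)` has as its terms the entries of the product in `W`. Each of (1)–(5) then follows by
reading off the terms of one element of `S` in two ways. -/

namespace AdequateTransversal

/-! ### Starred and ordinary Green's relations -/

section Green

variable {S : Type*} [Semigroup S]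

theorem RStar.symm {a b : S} (h : RStar a b) : RStar b a := fun x y => (h x y).symm

theorem LStar.symm {a b : S} (h : LStar a b) : LStar b a := fun x y => (h x y).symm

theorem RStar.trans {a b c : S} (h : RStar a b) (h' : RStar b c) : RStar a c :=
  fun x y => (h x y).trans (h' x y)

theorem LStar.trans {a b c : S} (h : LStar a b) (h' : LStar b c) : LStar a c :=
  fun x y => (h x y).trans (h' x y)

theorem RStar.mul_eq_mul {a b : S} (h : RStar a b) {x y : S} (hxy : x * a = y * a) :
    x * b = y * b := by
  have := (h x y).1 (by rw [← WithOne.coe_mul, hxy, WithOne.coe_mul])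
  rwa [← WithOne.coe_mul, ← WithOne.coe_mul, WithOne.coe_inj] at this

theorem LStar.mul_eq_mul {a b : S} (h : LStar a b) {x y : S} (hxy : a * x = a * y) :
    b * x = b * y := by
  have := (h x y).1 (by rw [← WithOne.coe_mul, hxy, WithOne.coe_mul])
  rwa [← WithOne.coe_mul, ← WithOne.coe_mul, WithOne.coe_inj] at this

theorem RStar.mul_eq_self {a b : S} (h : RStar a b) {x : S} (hx : x * a = a) : x * b = b := by
  have := (h x 1).1 (by rw [← WithOne.coe_mul, hx, one_mul])
  rwa [one_mul, ← WithOne.coe_mul, WithOne.coe_inj] at this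

theorem LStar.mul_eq_self {a b : S} (h : LStar a b) {x : S} (hx : a * x = a) : b * x = b := by
  have := (h x 1).1 (by rw [← WithOne.coe_mul, hx, mul_one])
  rwa [mul_one, ← WithOne.coe_mul, WithOne.coe_inj] at this

/-- The adjoined identity needs no separate hypothesis: because `e e = e` and `e a = a`, the element
`e` plays its role on both sides. -/
theorem rstar_of_mul_eq_mul {e a : S} (he : IsIdempotentElem e) (hea : e * a = a)
    (H : ∀ x y : S, x * a = y * a → x * e = y * e) : RStar e a := by
  have he' : e * e = e := he
  have key : ∀ x y : S, x * e = y * e ↔ x * a = y * a := fun x y =>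
    ⟨fun h => by rw [← hea, ← mul_assoc, h, mul_assoc], H x y⟩
  have key1 : ∀ x : S, x * e = e ↔ x * a = a := fun x => by
    have := key x e
    rwa [he', hea] at this
  intro x y
  induction x using WithOne.recOneCoe <;> induction y using WithOne.recOneCoe <;>
    simp only [one_mul, ← WithOne.coe_mul, WithOne.coe_inj]
  · exact eq_comm.trans ((key1 _).trans eq_comm)
  · exact key1 _
  · exact key _ _

theorem lstar_of_mul_eq_mul {e a : S} (he : IsIdempotentElem e) (hea : a * e = a)
    (H : ∀ x y : S, a * x = a * y → e * x = e * y) : LStar e a := by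
  have he' : e * e = e := he
  have key : ∀ x y : S, e * x = e * y ↔ a * x = a * y := fun x y =>
    ⟨fun h => by rw [← hea, mul_assoc, h, mul_assoc], H x y⟩
  have key1 : ∀ x : S, e * x = e ↔ a * x = a := fun x => by
    have := key x e
    rwa [he', hea] at this
  intro x y
  induction x using WithOne.recOneCoe <;> induction y using WithOne.recOneCoe <;>
    simp only [mul_one, ← WithOne.coe_mul, WithOne.coe_inj]
  · exact eq_comm.trans ((key1 _).trans eq_comm)
  · exact key1 _
  · exact key _ _

theorem greenL_of_mul {a b : S} (hab : a * b = a) (hba : b * a = b) : GreenL a b :=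
  ⟨⟨b, by rw [← WithOne.coe_mul, hba]⟩, ⟨a, by rw [← WithOne.coe_mul, hab]⟩⟩

theorem greenR_of_mul {a b : S} (hab : a * b = b) (hba : b * a = a) : GreenR a b :=
  ⟨⟨b, by rw [← WithOne.coe_mul, hab]⟩, ⟨a, by rw [← WithOne.coe_mul, hba]⟩⟩

theorem GreenL.symm {a b : S} (h : GreenL a b) : GreenL b a := ⟨h.2, h.1⟩

theorem GreenR.symm {a b : S} (h : GreenR a b) : GreenR b a := ⟨h.2, h.1⟩

theorem GreenL.mul_left_eq {a b : S} (h : GreenL a b) (hb : IsIdempotentElem b) : a * b = a := by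
  obtain ⟨-, v, hv⟩ := h
  rw [← WithOne.coe_inj, WithOne.coe_mul, ← hv, mul_assoc, ← WithOne.coe_mul, hb.eq]

theorem GreenR.mul_right_eq {a b : S} (h : GreenR a b) (hb : IsIdempotentElem b) : b * a = a := by
  obtain ⟨-, v, hv⟩ := h
  rw [← WithOne.coe_inj, WithOne.coe_mul, ← hv, ← mul_assoc, ← WithOne.coe_mul, hb.eq]

theorem rstar_of_mul {e f : S} (he : IsIdempotentElem e) (h : e * f = f) (h' : f * e = e) :
    RStar e f :=
  rstar_of_mul_eq_mul he h fun x y hxy => by rw [← h', ← mul_assoc, hxy, mul_assoc]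

theorem lstar_of_mul {e f : S} (he : IsIdempotentElem e) (h : f * e = f) (h' : e * f = e) :
    LStar e f :=
  lstar_of_mul_eq_mul he h fun x y hxy => by rw [← h', mul_assoc, hxy, mul_assoc]

/-- `U¹` embeds in `S¹`, so there are fewer equations to test in `U`. The reverse implication fails
in general. -/
theorem rstar_coe {U : Subsemigroup S} {a b : U} (h : RStar (a : S) (b : S)) : RStar a b := by
  have inj : Function.Injective (WithOne.mapMulHom (MulMemClass.subtype U)) :=
    WithOne.mapMulHom_injective Subtype.coe_injective
  intro x y
  have := h (WithOne.mapMulHom (MulMemClass.subtype U) x) (WithOne.mapMulHom (MulMemClass.subtype U) y)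
  have e : ∀ c : U, ((c : S) : WithOne S) = WithOne.mapMulHom (MulMemClass.subtype U) c := fun c => rfl
  rw [e, e, ← map_mul, ← map_mul, ← map_mul, ← map_mul, inj.eq_iff, inj.eq_iff] at this
  exact this

theorem lstar_coe {U : Subsemigroup S} {a b : U} (h : LStar (a : S) (b : S)) : LStar a b := by
  have inj : Function.Injective (WithOne.mapMulHom (MulMemClass.subtype U)) :=
    WithOne.mapMulHom_injective Subtype.coe_injective
  intro x y
  have := h (WithOne.mapMulHom (MulMemClass.subtype U) x) (WithOne.mapMulHom (MulMemClass.subtype U) y)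
  have e : ∀ c : U, ((c : S) : WithOne S) = WithOne.mapMulHom (MulMemClass.subtype U) c := fun c => rfl
  rw [e, e, ← map_mul, ← map_mul, ← map_mul, ← map_mul, inj.eq_iff, inj.eq_iff] at this
  exact this

/-- Between idempotents, `ℛ*` and `ℒ*` amount to two equations, which hold in `U` exactly when they
hold in `S`. Idempotents of `U` related in `S` to the given elements therefore carry a relation from
`U` up to `S`. -/
theorem isStarSubsemigroup_of_exists {U : Subsemigroup S}
    (hr : ∀ a : U, ∃ e : U, IsIdempotentElem e ∧ RStar (e : S) (a : S))
    (hl : ∀ a : U, ∃ e : U, IsIdempotentElem e ∧ LStar (e : S) (a : S)) :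
    IsStarSubsemigroup U where
  abundant :=
    { exists_plus := fun a => let ⟨e, he, h⟩ := hr a; ⟨e, he, rstar_coe h⟩
      exists_ast := fun a => let ⟨e, he, h⟩ := hl a; ⟨e, he, lstar_coe h⟩ }
  lstar_iff a b := by
    refine ⟨fun h => ?_, lstar_coe⟩
    obtain ⟨e, he, hea⟩ := hl a
    obtain ⟨f, hf, hfb⟩ := hl b
    have key : LStar e f := ((lstar_coe hea).trans h).trans (lstar_coe hfb).symm
    have h1 : f * e = f := key.mul_eq_self he
    have h2 : e * f = e := key.symm.mul_eq_self hf
    refine (hea.symm.trans (lstar_of_mul ?_ ?_ ?_)).trans hfb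
    · exact congrArg Subtype.val he.eq
    · exact congrArg Subtype.val h1
    · exact congrArg Subtype.val h2
  rstar_iff a b := by
    refine ⟨fun h => ?_, rstar_coe⟩
    obtain ⟨e, he, hea⟩ := hr a
    obtain ⟨f, hf, hfb⟩ := hr b
    have key : RStar e f := ((rstar_coe hea).trans h).trans (rstar_coe hfb).symm
    have h1 : e * f = f := key.mul_eq_self he
    have h2 : f * e = e := key.symm.mul_eq_self hf
    refine (hea.symm.trans (rstar_of_mul ?_ ?_ ?_)).trans hfb
    · exact congrArg Subtype.val he.eq
    · exact congrArg Subtype.val h1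
    · exact congrArg Subtype.val h2

end Green

namespace IsAdequate

variable {S : Type*} [Semigroup S] (h : IsAdequate S)

theorem idem_comm (p q : h.idem) : p * q = q * p :=
  Subtype.ext (h.comm _ _ p.2 q.2)

theorem plus_mul (a : S) : (h.plus a : S) * a = a := (h.plus_rel a).mul_eq_self (h.plus a).2

theorem mul_ast (a : S) : a * (h.ast a : S) = a := (h.ast_rel a).mul_eq_self (h.ast a).2

theorem plus_coe (p : h.idem) : h.plus (p : S) = p :=
  Subtype.ext (h.eq_plus p.2 fun _ _ => Iff.rfl).symm

theorem ast_coe (p : h.idem) : h.ast (p : S) = p :=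
  Subtype.ext (h.eq_ast p.2 fun _ _ => Iff.rfl).symm

theorem plus_mul_plus_mul (a b : S) : h.plus a * h.plus (a * b) = h.plus (a * b) :=
  Subtype.ext ((h.plus_rel (a * b)).symm.mul_eq_self (by rw [← mul_assoc, h.plus_mul]))

theorem ast_mul_mul_ast (a b : S) : h.ast (a * b) * h.ast b = h.ast (a * b) :=
  Subtype.ext ((h.ast_rel (a * b)).symm.mul_eq_self (by rw [mul_assoc, h.mul_ast]))

theorem plus_mul_mul_plus (a b : S) : h.plus (a * b) * h.plus a = h.plus (a * b) := by
  rw [h.idem_comm, h.plus_mul_plus_mul]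

theorem ast_mul_ast_mul (a b : S) : h.ast b * h.ast (a * b) = h.ast (a * b) := by
  rw [h.idem_comm, h.ast_mul_mul_ast]

end IsAdequate

/-! ### Decompositions `x = e x̄ f` and the sets `I(S)`, `Λ(S)` -/

section Decompositions

variable {S : Type*} [Semigroup S] {S0 : Subsemigroup S}

theorem idem_coe_coe {h : IsAdequate S0} (p : h.idem) : IsIdempotentElem ((p : S0) : S) :=
  congrArg Subtype.val p.2

namespace Decomposes

variable {h : IsAdequate S0} {x e f : S} {s : S0}

theorem mul_plus (d : Decomposes h x e s f) : e * ((h.plus s : S0) : S) = e :=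
  d.left.mul_left_eq (idem_coe_coe _)

theorem plus_mul (d : Decomposes h x e s f) :
    ((h.plus s : S0) : S) * e = ((h.plus s : S0) : S) :=
  d.left.symm.mul_left_eq d.idem_left

theorem ast_mul (d : Decomposes h x e s f) : ((h.ast s : S0) : S) * f = f :=
  d.right.mul_right_eq (idem_coe_coe _)

theorem mul_ast (d : Decomposes h x e s f) :
    f * ((h.ast s : S0) : S) = ((h.ast s : S0) : S) :=
  d.right.symm.mul_right_eq d.idem_right

theorem self_mul_ast (d : Decomposes h x e s f) : x * ((h.ast s : S0) : S) = e * s := by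
  rw [d.eq, mul_assoc, d.mul_ast, mul_assoc, ← MulMemClass.coe_mul, h.mul_ast]

theorem plus_mul_self (d : Decomposes h x e s f) : ((h.plus s : S0) : S) * x = s * f := by
  rw [d.eq, ← mul_assoc, ← mul_assoc, d.plus_mul, ← MulMemClass.coe_mul, h.plus_mul]

theorem of_mul {h : IsAdequate S0} {x e f : S} {s : S0} (he : IsIdempotentElem e)
    (hf : IsIdempotentElem f)
    (hx : x = e * s * f) (h1 : e * ((h.plus s : S0) : S) = e)
    (h2 : ((h.plus s : S0) : S) * e = ((h.plus s : S0) : S))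
    (h3 : f * ((h.ast s : S0) : S) = ((h.ast s : S0) : S))
    (h4 : ((h.ast s : S0) : S) * f = f) : Decomposes h x e s f :=
  ⟨he, hf, hx, greenL_of_mul h1 h2, greenR_of_mul h3 h4⟩

/-- Elements of the transversal decompose as `s = s⁺ s s*`. -/
theorem coe (h : IsAdequate S0) (s : S0) :
    Decomposes h (s : S) ((h.plus s : S0) : S) s ((h.ast s : S0) : S) :=
  .of_mul (idem_coe_coe _) (idem_coe_coe _)
    (by rw [← MulMemClass.coe_mul, ← MulMemClass.coe_mul, h.plus_mul, h.mul_ast])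
    (idem_coe_coe _) (idem_coe_coe _) (idem_coe_coe _) (idem_coe_coe _)

/-- An idempotent that is `ℒ`-related to `p ∈ E⁰` factors as `e = e p p`. This makes the middle term
of any element of `I(S)` computable. -/
theorem of_left {h : IsAdequate S0} {e : S} {p : h.idem} (he : IsIdempotentElem e)
    (h1 : e * ((p : S0) : S) = e) (h2 : ((p : S0) : S) * e = ((p : S0) : S)) :
    Decomposes h e e (p : S0) ((p : S0) : S) := by
  have hp := idem_coe_coe p
  apply of_mul he hp <;> (try rw [h.ast_coe]) <;> try rw [h.plus_coe]
  all_goals first | assumption | exact hp | rw [h1, h1]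

theorem of_right {h : IsAdequate S0} {f : S} {p : h.idem} (hf : IsIdempotentElem f)
    (h1 : f * ((p : S0) : S) = ((p : S0) : S)) (h2 : ((p : S0) : S) * f = f) :
    Decomposes h f ((p : S0) : S) (p : S0) f := by
  have hp := idem_coe_coe p
  apply of_mul hp hf <;> (try rw [h.ast_coe]) <;> try rw [h.plus_coe]
  all_goals first | assumption | exact hp | rw [hp.eq, h2]

/-- With `s⁺ ≤ p` and `p g = p`, one gets `s⁺ g e = s⁺ p g e = s⁺ p e = s⁺`, so `g e` is still
`ℒ`-related to `s⁺`. Quasi-adequacy supplies the idempotency of `g e`. -/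
theorem mul_left (hS : IsQuasiAdequate S) (d : Decomposes h x e s f) {g : S} {p : h.idem}
    (hg : IsIdempotentElem g) (hpg : ((p : S0) : S) * g = ((p : S0) : S))
    (hp : h.plus s * p = h.plus s) : Decomposes h (g * x) (g * e) s f := by
  have hp' : ((h.plus s : S0) : S) * ((p : S0) : S) = ((h.plus s : S0) : S) := by
    rw [← MulMemClass.coe_mul, ← MulMemClass.coe_mul, hp]
  refine .of_mul (hS.mul_idem _ _ hg d.idem_left) d.idem_right ?_ ?_ ?_ d.mul_ast d.ast_mul
  · rw [d.eq]; simp only [mul_assoc]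
  · rw [mul_assoc, d.mul_plus]
  · rw [← hp', mul_assoc, ← mul_assoc _ g e, hpg, ← mul_assoc, hp', d.plus_mul]

theorem mul_right (hS : IsQuasiAdequate S) (d : Decomposes h x e s f) {g : S} {p : h.idem}
    (hg : IsIdempotentElem g) (hpg : g * ((p : S0) : S) = ((p : S0) : S))
    (hp : p * h.ast s = h.ast s) : Decomposes h (x * g) e s (f * g) := by
  have hp' : ((p : S0) : S) * ((h.ast s : S0) : S) = ((h.ast s : S0) : S) := by
    rw [← MulMemClass.coe_mul, ← MulMemClass.coe_mul, hp]
  refine .of_mul d.idem_left (hS.mul_idem _ _ d.idem_right hg) ?_ d.mul_plus d.plus_mul ?_ ?_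
  · rw [d.eq]; simp only [mul_assoc]
  · rw [← hp', mul_assoc, ← mul_assoc g, hpg, hp', d.mul_ast]
  · rw [← mul_assoc, d.ast_mul]

end Decomposes

namespace IsAdequateTransversal

variable (hT : IsAdequateTransversal S0)

theorem rstar_plus (s : S0) : RStar ((hT.adequate.plus s : S0) : S) (s : S) :=
  (hT.starSub.rstar_iff _ _).1 (hT.adequate.plus_rel s)

theorem lstar_ast (s : S0) : LStar ((hT.adequate.ast s : S0) : S) (s : S) :=
  (hT.starSub.lstar_iff _ _).1 (hT.adequate.ast_rel s)

theorem _root_.AdequateTransversal.Decomposes.bar_eq {hT : IsAdequateTransversal S0} {x e f : S} {s : S0} (d : Decomposes hT.adequate x e s f) : hT.bar x = s :=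
  (hT.existsUnique_bar x).unique (hT.existsUnique_bar x).choose_spec.1 ⟨e, f, d⟩

theorem exists_decomposes (x : S) : ∃ e f, Decomposes hT.adequate x e (hT.bar x) f :=
  (hT.existsUnique_bar x).choose_spec.1

/-- The middle terms agree by definition of a transversal. Then `x s* = e s = e' s`, and `s ℛ* s⁺`
in `S` turns this into `e s⁺ = e' s⁺`, that is, `e = e'`; dually for `f`. -/
theorem decomposes_unique {x e e' f f' : S} {s s' : S0} (d : Decomposes hT.adequate x e s f)
    (d' : Decomposes hT.adequate x e' s' f') : e = e' ∧ s = s' ∧ f = f' := by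
  obtain rfl : s = s' := by rw [← d.bar_eq (hT := hT), ← d'.bar_eq (hT := hT)]
  refine ⟨?_, rfl, ?_⟩
  · have := (hT.rstar_plus s).symm.mul_eq_mul (d.self_mul_ast.symm.trans d'.self_mul_ast)
    rwa [d.mul_plus, d'.mul_plus] at this
  · have := (hT.lstar_ast s).symm.mul_eq_mul (d.plus_mul_self.symm.trans d'.plus_mul_self)
    rwa [d.ast_mul, d'.ast_mul] at this

/-- Describes `I(S)` without reference to the elements being decomposed: it consists of the
idempotents `ℒ`-related to some member of `E⁰`. -/
theorem mem_leftFactors {e : S} : e ∈ hT.leftFactors ↔ IsIdempotentElem e ∧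
    ∃ p : hT.adequate.idem,
      e * ((p : S0) : S) = e ∧ ((p : S0) : S) * e = ((p : S0) : S) := by
  constructor
  · rintro ⟨x, f, d⟩
    exact ⟨d.idem_left, _, d.mul_plus, d.plus_mul⟩
  · rintro ⟨he, p, h1, h2⟩
    have d := Decomposes.of_left he h1 h2
    refine ⟨e, ((p : S0) : S), ?_⟩
    rw [d.bar_eq]
    exact d

theorem mem_rightFactors {f : S} : f ∈ hT.rightFactors ↔ IsIdempotentElem f ∧
    ∃ p : hT.adequate.idem,
      f * ((p : S0) : S) = ((p : S0) : S) ∧ ((p : S0) : S) * f = f := by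
  constructor
  · rintro ⟨x, e, d⟩
    exact ⟨d.idem_right, _, d.mul_ast, d.ast_mul⟩
  · rintro ⟨hf, p, h1, h2⟩
    have d := Decomposes.of_right hf h1 h2
    refine ⟨f, ((p : S0) : S), ?_⟩
    rw [d.bar_eq]
    exact d

/-- By admissibility `e g = a (pq) b` with middle term `pq`. Multiplying by `pq` on the left gives
`b = pq`, hence `e g = a`, a left factor belonging to `pq`. -/
theorem mul_leftFactors (hA : hT.Admissible) {e g : S}
    {p q : hT.adequate.idem} (he : IsIdempotentElem e) (hg : IsIdempotentElem g)
    (h1 : e * ((p : S0) : S) = e) (h2 : ((p : S0) : S) * e = ((p : S0) : S))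
    (h3 : g * ((q : S0) : S) = g) (h4 : ((q : S0) : S) * g = ((q : S0) : S)) :
    e * g * ((p * q : hT.adequate.idem) : S0) = e * g ∧
    (((p * q : hT.adequate.idem) : S0) : S) * (e * g) = ((p * q : hT.adequate.idem) : S0) := by
  have hpq : (((p * q : hT.adequate.idem) : S0) : S) = ((p : S0) : S) * ((q : S0) : S) := rfl
  have hqp : (((p * q : hT.adequate.idem) : S0) : S) = ((q : S0) : S) * ((p : S0) : S) := by
    rw [hT.adequate.idem_comm]; rfl
  have key : (((p * q : hT.adequate.idem) : S0) : S) * (e * g) =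
      ((p * q : hT.adequate.idem) : S0) := by
    rw [hqp, mul_assoc, ← mul_assoc _ e g, h2, ← mul_assoc, ← hqp, hpq, mul_assoc, h4]
  refine ⟨?_, key⟩
  obtain ⟨a, b, d⟩ := hT.exists_decomposes (e * g)
  rw [hA, (Decomposes.of_left he h1 h2).bar_eq, (Decomposes.of_left hg h3 h4).bar_eq] at d
  change Decomposes _ _ _ ((p * q : hT.adequate.idem) : S0) _ at d
  have d1 := d.mul_plus
  have d2 := d.ast_mul
  have d3 := d.plus_mul_self
  rw [hT.adequate.plus_coe] at d1 d3
  rw [hT.adequate.ast_coe] at d2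
  rw [key, d2] at d3
  have d4 := d.eq
  rw [← d3, d1, d1] at d4
  rw [d4, d1]

theorem mul_rightFactors (hA : hT.Admissible) {e g : S}
    {p q : hT.adequate.idem} (he : IsIdempotentElem e) (hg : IsIdempotentElem g)
    (h1 : e * ((p : S0) : S) = ((p : S0) : S)) (h2 : ((p : S0) : S) * e = e)
    (h3 : g * ((q : S0) : S) = ((q : S0) : S)) (h4 : ((q : S0) : S) * g = g) :
    e * g * ((p * q : hT.adequate.idem) : S0) = ((p * q : hT.adequate.idem) : S0) ∧
    (((p * q : hT.adequate.idem) : S0) : S) * (e * g) = e * g := by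
  have hpq : (((p * q : hT.adequate.idem) : S0) : S) = ((p : S0) : S) * ((q : S0) : S) := rfl
  have hqp : (((p * q : hT.adequate.idem) : S0) : S) = ((q : S0) : S) * ((p : S0) : S) := by
    rw [hT.adequate.idem_comm]; rfl
  have key : e * g * ((p * q : hT.adequate.idem) : S0) = ((p * q : hT.adequate.idem) : S0) := by
    rw [hqp, mul_assoc, ← mul_assoc g, h3, ← hqp, hpq, ← mul_assoc, h1]
  refine ⟨key, ?_⟩
  obtain ⟨a, b, d⟩ := hT.exists_decomposes (e * g)
  rw [hA, (Decomposes.of_right he h1 h2).bar_eq, (Decomposes.of_right hg h3 h4).bar_eq] at d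
  change Decomposes _ _ _ ((p * q : hT.adequate.idem) : S0) _ at d
  have d1 := d.mul_plus
  have d2 := d.ast_mul
  have d3 := d.self_mul_ast
  rw [hT.adequate.plus_coe] at d1
  rw [hT.adequate.ast_coe] at d2 d3
  rw [key, d1] at d3
  have d4 := d.eq
  rw [← d3, mul_assoc, d2, d2] at d4
  rw [d4, d2]

/-- `I(S)` as a subsemigroup. -/
def leftSub (hS : IsQuasiAdequate S) (hA : hT.Admissible) :
    Subsemigroup S where
  carrier := hT.leftFactors
  mul_mem' := by
    intro a b ha hb
    obtain ⟨ha, p, h1, h2⟩ := hT.mem_leftFactors.1 ha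
    obtain ⟨hb, q, h3, h4⟩ := hT.mem_leftFactors.1 hb
    exact hT.mem_leftFactors.2
      ⟨hS.mul_idem _ _ ha hb, _, hT.mul_leftFactors hA ha hb h1 h2 h3 h4⟩

/-- `Λ(S)` as a subsemigroup. -/
def rightSub (hS : IsQuasiAdequate S) (hA : hT.Admissible) :
    Subsemigroup S where
  carrier := hT.rightFactors
  mul_mem' := by
    intro a b ha hb
    obtain ⟨ha, p, h1, h2⟩ := hT.mem_rightFactors.1 ha
    obtain ⟨hb, q, h3, h4⟩ := hT.mem_rightFactors.1 hb
    exact hT.mem_rightFactors.2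
      ⟨hS.mul_idem _ _ ha hb, _, hT.mul_rightFactors hA ha hb h1 h2 h3 h4⟩

end IsAdequateTransversal

end Decompositions

/-! ### Inverses in regular bands -/

section SemilatticeTransversal

variable {E B : Type*} [Semigroup E] [Semigroup B] {i : E →ₙ* B}

theorem IsSemilatticeTransversal.zero_eq (ht : IsSemilatticeTransversal i) {b : B} {p : E}
    (hp : IsInverse b (i p)) : ht.zero b = p :=
  (ht.existsUnique_inverse b).unique (ht.existsUnique_inverse b).choose_spec.1 hp

theorem IsSemilatticeTransversal.isInverse_zero (ht : IsSemilatticeTransversal i) (b : B) :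
    IsInverse b (i (ht.zero b)) :=
  (ht.existsUnique_inverse b).choose_spec.1

/-- Left regularity collapses `aba` to `ab`, so mutual inverses in `I` are just `ℒ`-related
elements. Thus `e⁰ = p` means `e ∈ L_p`. -/
theorem IsLeftRegularBand.mul_eq_of_isInverse (hB : IsLeftRegularBand B) {a b : B}
    (h : IsInverse a b) : a * b = a ∧ b * a = b := by
  rw [IsInverse, hB.left_regular, hB.left_regular] at h
  exact h

theorem IsRightRegularBand.mul_eq_of_isInverse (hB : IsRightRegularBand B) {a b : B}
    (h : IsInverse a b) : a * b = b ∧ b * a = a := by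
  rw [IsInverse, hB.right_regular, hB.right_regular] at h
  exact h.symm

end SemilatticeTransversal

/-! ### The semigroup `W` built from twisted data -/

namespace TwistedData

variable {S0 : Type*} [Semigroup S0] {h : IsAdequate S0} {I Λ : Type*}
  [Semigroup I] [Semigroup Λ] (D : TwistedData h I Λ)

theorem toI_idem (p : h.idem) : IsIdempotentElem (D.toI p) := D.leftRegular.idem _

theorem toΛ_idem (p : h.idem) : IsIdempotentElem (D.toΛ p) := D.rightRegular.idem _

variable {D} in
theorem mem_Lcl {e : I} {p : h.idem} :
    e ∈ D.Lcl p ↔ e * D.toI p = e ∧ D.toI p * e = D.toI p :=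
  ⟨fun he => ⟨GreenL.mul_left_eq he (D.toI_idem p), he.symm.mul_left_eq (D.leftRegular.idem e)⟩,
    fun he => greenL_of_mul he.1 he.2⟩

variable {D} in
theorem mem_Rcl {f : Λ} {p : h.idem} :
    f ∈ D.Rcl p ↔ f * D.toΛ p = D.toΛ p ∧ D.toΛ p * f = f :=
  ⟨fun hf => ⟨hf.symm.mul_right_eq (D.rightRegular.idem f), GreenR.mul_right_eq hf (D.toΛ_idem p)⟩,
    fun hf => greenR_of_mul hf.1 hf.2⟩

theorem toI_mem (p : h.idem) : D.toI p ∈ D.Lcl p := mem_Lcl.2 ⟨D.toI_idem p, D.toI_idem p⟩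

theorem toΛ_mem (p : h.idem) : D.toΛ p ∈ D.Rcl p := mem_Rcl.2 ⟨D.toΛ_idem p, D.toΛ_idem p⟩

variable {D} in
theorem mul_mem_Lcl {e a : I} {p q : h.idem} (he : e ∈ D.Lcl p) (ha : a ∈ D.Lcl q)
    (hpq : q * p = q) : e * a ∈ D.Lcl q := by
  rw [mem_Lcl] at *
  refine ⟨by rw [mul_assoc, ha.1], ?_⟩
  rw [← mul_assoc]
  nth_rw 1 [← hpq]
  rw [map_mul, mul_assoc _ _ e, he.2, ← map_mul, hpq, ha.2]

variable {D} in
theorem mul_mem_Rcl {f b : Λ} {p q : h.idem} (hf : f ∈ D.Rcl p) (hb : b ∈ D.Rcl q)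
    (hpq : p * q = q) : b * f ∈ D.Rcl q := by
  rw [mem_Rcl] at *
  refine ⟨?_, by rw [← mul_assoc, hb.2]⟩
  rw [mul_assoc]
  nth_rw 1 [← hpq]
  rw [map_mul, ← mul_assoc f, hf.1, ← map_mul, hpq, hb.1]

theorem α_mem_Lcl {x y : S0} {f : Λ} {g : I} (hf : f ∈ D.Rcl (h.ast x))
    (hg : g ∈ D.Lcl (h.plus y)) : D.α x y f g ∈ D.Lcl (h.plus (x * y)) := D.α_mem x y f g hf hg

theorem β_mem_Rcl {x y : S0} {f : Λ} {g : I} (hf : f ∈ D.Rcl (h.ast x))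
    (hg : g ∈ D.Lcl (h.plus y)) : D.β x y f g ∈ D.Rcl (h.ast (x * y)) := D.β_mem x y f g hf hg

/-- The twisted product on `W`. -/
@[reducible]
def mulW : Mul D.W where
  mul a b :=
    { e := a.e * D.α a.x b.x a.f b.e
      x := a.x * b.x
      f := D.β a.x b.x a.f b.e * b.f
      e_mem := mul_mem_Lcl a.e_mem (D.α_mem_Lcl a.f_mem b.e_mem) (h.plus_mul_mul_plus _ _)
      f_mem := mul_mem_Rcl b.f_mem (D.β_mem_Rcl a.f_mem b.e_mem) (h.ast_mul_ast_mul _ _) }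

/-- Condition (1) makes the twisted product associative. -/
@[reducible]
def semigroupW (h1 : D.Cond1) : Semigroup D.W where
  toMul := D.mulW
  mul_assoc a b c := by
    have key := h1 a.x b.x c.x a.f a.f_mem b.e b.e_mem b.f b.f_mem c.e c.e_mem
    apply W.ext
    · change a.e * D.α a.x b.x a.f b.e * D.α (a.x * b.x) c.x (D.β a.x b.x a.f b.e * b.f) c.e =
        a.e * D.α a.x (b.x * c.x) a.f (b.e * D.α b.x c.x b.f c.e)
      rw [mul_assoc, key.1]
    · exact mul_assoc a.x b.x c.x
    · change D.β (a.x * b.x) c.x (D.β a.x b.x a.f b.e * b.f) c.e * c.f =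
        D.β a.x (b.x * c.x) a.f (b.e * D.α b.x c.x b.f c.e) * (D.β b.x c.x b.f c.e * c.f)
      rw [← mul_assoc, key.2]

theorem semigroupW_isTwistedMul (h1 : D.Cond1) :
    letI := D.semigroupW h1; D.IsTwistedMul :=
  fun _ _ => ⟨rfl, rfl, rfl⟩

/-- `(e, x⁺, x⁺)`. -/
@[simps]
noncomputable def leftProj (w : D.W) : D.W where
  e := w.e
  x := h.plus w.x
  f := D.toΛ (h.plus w.x)
  e_mem := by rw [h.plus_coe]; exact w.e_mem
  f_mem := by rw [h.ast_coe]; exact D.toΛ_mem _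

/-- `(x*, x*, f)`. -/
@[simps]
noncomputable def rightProj (w : D.W) : D.W where
  e := D.toI (h.ast w.x)
  x := h.ast w.x
  f := w.f
  e_mem := by rw [h.plus_coe]; exact D.toI_mem _
  f_mem := by rw [h.ast_coe]; exact w.f_mem

variable {D}

theorem leftProj_diag (x : S0) : D.leftProj (D.diag x) = D.diag (h.plus x : S0) :=
  W.ext (congrArg D.toI (h.plus_coe _).symm) rfl (congrArg D.toΛ (h.ast_coe _).symm)

theorem rightProj_diag (x : S0) : D.rightProj (D.diag x) = D.diag (h.ast x : S0) :=
  W.ext (congrArg D.toI (h.plus_coe _).symm) rfl (congrArg D.toΛ (h.ast_coe _).symm)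

theorem zero_I_mem (e : I) : e ∈ D.Lcl (D.transI.zero e) :=
  mem_Lcl.2 (D.leftRegular.mul_eq_of_isInverse (D.transI.isInverse_zero e))

theorem zero_Λ_mem (f : Λ) : f ∈ D.Rcl (D.transΛ.zero f) :=
  mem_Rcl.2 (D.rightRegular.mul_eq_of_isInverse (D.transΛ.isInverse_zero f))

theorem zero_I_eq {e : I} {p : h.idem} (he : e ∈ D.Lcl p) : D.transI.zero e = p := by
  rw [mem_Lcl] at he
  apply D.transI.zero_eq
  rw [IsInverse, he.1, he.2]
  exact ⟨D.leftRegular.idem e, D.toI_idem p⟩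

theorem zero_Λ_eq {f : Λ} {p : h.idem} (hf : f ∈ D.Rcl p) : D.transΛ.zero f = p := by
  rw [mem_Rcl] at hf
  apply D.transΛ.zero_eq
  rw [IsInverse, hf.1, hf.2]
  exact ⟨rfl, hf.1⟩

/-- The first entry determines `x⁺`, since `x⁺ = e⁰`. -/
theorem leftProj_eq_of_e {a b : D.W} (hab : a.e = b.e) : D.leftProj a = D.leftProj b := by
  have : h.plus a.x = h.plus b.x := by
    rw [← zero_I_eq a.e_mem, ← zero_I_eq b.e_mem, hab]
  apply W.ext
  · exact hab
  · rw [leftProj_x, this, leftProj_x]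
  · rw [leftProj_f, this, leftProj_f]

theorem rightProj_eq_of_f {a b : D.W} (hab : a.f = b.f) : D.rightProj a = D.rightProj b := by
  have : h.ast a.x = h.ast b.x := by
    rw [← zero_Λ_eq a.f_mem, ← zero_Λ_eq b.f_mem, hab]
  apply W.ext
  · rw [rightProj_e, this, rightProj_e]
  · rw [rightProj_x, this, rightProj_x]
  · exact hab

variable [Semigroup D.W]

namespace IsTwistedMul

theorem mul_x (hm : D.IsTwistedMul) (a b : D.W) : (a * b).x = a.x * b.x := (hm a b).2.1

/-- The absorption rule: `α` takes its value in `L_{x⁺}`, so `e α = e x⁺ α = e x⁺ = e`. No other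
knowledge of `α` is needed. -/
theorem mul_e_of_plus (hm : D.IsTwistedMul) (a b : D.W) (hp : h.plus (a.x * b.x) = h.plus a.x) : (a * b).e = a.e := by
  rw [(hm a b).1]
  have hα := D.α_mem_Lcl a.f_mem b.e_mem
  rw [hp, mem_Lcl] at hα
  rw [← (mem_Lcl.1 a.e_mem).1, mul_assoc, hα.2]

theorem mul_f_of_ast (hm : D.IsTwistedMul) (a b : D.W) (hp : h.ast (a.x * b.x) = h.ast b.x) : (a * b).f = b.f := by
  rw [(hm a b).2.2]
  have hβ := D.β_mem_Rcl a.f_mem b.e_mem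
  rw [hp, mem_Rcl] at hβ
  rw [← (mem_Rcl.1 b.f_mem).2, ← mul_assoc, hβ.1]

theorem leftProj_mul (hm : D.IsTwistedMul) (w : D.W) : D.leftProj w * w = w := by
  have hx : (D.leftProj w).x * w.x = w.x := h.plus_mul _
  apply W.ext
  · exact hm.mul_e_of_plus _ _ (by rw [hx, leftProj_x, h.plus_coe])
  · rw [hm.mul_x, hx]
  · exact hm.mul_f_of_ast _ _ (by rw [hx])

theorem mul_rightProj (hm : D.IsTwistedMul) (w : D.W) : w * D.rightProj w = w := by
  have hx : w.x * (D.rightProj w).x = w.x := h.mul_ast _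
  apply W.ext
  · exact hm.mul_e_of_plus _ _ (by rw [hx])
  · rw [hm.mul_x, hx]
  · exact hm.mul_f_of_ast _ _ (by rw [hx, rightProj_x, h.ast_coe])

/-- If `x² = x`, both absorption rules apply to `w w`, so the outer entries are automatically
preserved. -/
theorem isIdempotentElem_iff (hm : D.IsTwistedMul) (w : D.W) : IsIdempotentElem w ↔ IsIdempotentElem w.x := by
  constructor
  · intro hw
    exact (hm.mul_x w w).symm.trans (congrArg W.x hw.eq)
  · intro hx
    have hx' : w.x * w.x = w.x := hx
    exact W.ext (hm.mul_e_of_plus _ _ (by rw [hx'])) ((hm.mul_x w w).trans hx)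
      (hm.mul_f_of_ast _ _ (by rw [hx']))

theorem isIdempotentElem_leftProj (hm : D.IsTwistedMul) (w : D.W) : IsIdempotentElem (D.leftProj w) :=
  (hm.isIdempotentElem_iff _).2 (h.plus w.x).2

theorem isIdempotentElem_rightProj (hm : D.IsTwistedMul) (w : D.W) : IsIdempotentElem (D.rightProj w) :=
  (hm.isIdempotentElem_iff _).2 (h.ast w.x).2

/-- Condition (3) is this cancellation property written out entry by entry. -/
theorem rstar_leftProj (hm : D.IsTwistedMul) (h3 : D.Cond3) (w : D.W) : RStar (D.leftProj w) w := by
  refine rstar_of_mul_eq_mul (hm.isIdempotentElem_leftProj w) (hm.leftProj_mul w) ?_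
  intro a b hab
  have he := congrArg W.e hab
  have hx := congrArg W.x hab
  have hf := congrArg W.f hab
  rw [(hm _ _).1, (hm _ _).1] at he
  rw [(hm _ _).2.1, (hm _ _).2.1] at hx
  rw [(hm _ _).2.2, (hm _ _).2.2] at hf
  -- Condition (3) involves `x*` rather than `f`; since `f x* = x*`, multiplying by `x*` removes
  -- `f`.
  have hf' := congrArg (· * D.toΛ (h.ast w.x)) hf
  simp only [mul_assoc, (mem_Rcl.1 w.f_mem).1] at hf'
  obtain ⟨k1, k2, k3⟩ := h3 w.x a.x b.x a.e a.e_mem a.f a.f_mem b.e b.e_mem b.f b.f_mem w.e w.e_mem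
    he hx hf'
  apply W.ext
  · rw [(hm _ _).1, (hm _ _).1]; exact k1
  · rw [(hm _ _).2.1, (hm _ _).2.1]; exact k2
  · rw [(hm _ _).2.2, (hm _ _).2.2, leftProj_x, leftProj_e, k3]

theorem lstar_rightProj (hm : D.IsTwistedMul) (h4 : D.Cond4) (w : D.W) : LStar (D.rightProj w) w := by
  refine lstar_of_mul_eq_mul (hm.isIdempotentElem_rightProj w) (hm.mul_rightProj w) ?_
  intro a b hab
  have he := congrArg W.e hab
  have hx := congrArg W.x hab
  have hf := congrArg W.f hab
  rw [(hm _ _).1, (hm _ _).1] at he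
  rw [(hm _ _).2.1, (hm _ _).2.1] at hx
  rw [(hm _ _).2.2, (hm _ _).2.2] at hf
  -- Dually, `x⁺ e = x⁺` removes the first entry of `w`.
  have he' := congrArg (D.toI (h.plus w.x) * ·) he
  simp only [← mul_assoc, (mem_Lcl.1 w.e_mem).2] at he'
  obtain ⟨k1, k2, k3⟩ := h4 w.x a.x b.x a.e a.e_mem a.f a.f_mem b.e b.e_mem b.f b.f_mem w.f w.f_mem
    he' hx hf
  apply W.ext
  · rw [(hm _ _).1, (hm _ _).1, rightProj_x, rightProj_f, k1]
  · rw [(hm _ _).2.1, (hm _ _).2.1]; exact k2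
  · rw [(hm _ _).2.2, (hm _ _).2.2]; exact k3

theorem isQuasiAdequate (hm : D.IsTwistedMul) (h3 : D.Cond3) (h4 : D.Cond4) : IsQuasiAdequate D.W where
  exists_plus w := ⟨_, hm.isIdempotentElem_leftProj w, hm.rstar_leftProj h3 w⟩
  exists_ast w := ⟨_, hm.isIdempotentElem_rightProj w, hm.lstar_rightProj h4 w⟩
  mul_idem a b ha hb := by
    rw [hm.isIdempotentElem_iff] at *
    rw [hm.mul_x]
    exact (h.idem.mul_mem ha hb : _)

theorem diag_mul (hm : D.IsTwistedMul) (h2 : D.Cond2) (x y : S0) : D.diag x * D.diag y = D.diag (x * y) := by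
  apply W.ext
  · rw [(hm _ _).1]
    change D.toI (h.plus x) * D.α x y (D.toΛ (h.ast x)) (D.toI (h.plus y)) = D.toI (h.plus (x * y))
    rw [(h2 x y).1, ← map_mul, h.plus_mul_plus_mul]
  · exact hm.mul_x _ _
  · rw [(hm _ _).2.2]
    change D.β x y (D.toΛ (h.ast x)) (D.toI (h.plus y)) * D.toΛ (h.ast y) = D.toΛ (h.ast (x * y))
    rw [(h2 x y).2, ← map_mul, h.ast_mul_mul_ast]

theorem rstar_diag_plus (hm : D.IsTwistedMul) (h3 : D.Cond3) (x : S0) :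
    RStar (D.diag (h.plus x : S0)) (D.diag x) := by
  have := hm.rstar_leftProj h3 (D.diag x)
  rwa [leftProj_diag] at this

theorem lstar_diag_ast (hm : D.IsTwistedMul) (h4 : D.Cond4) (x : S0) :
    LStar (D.diag (h.ast x : S0)) (D.diag x) := by
  have := hm.lstar_rightProj h4 (D.diag x)
  rwa [rightProj_diag] at this

theorem isIdempotentElem_diag (hm : D.IsTwistedMul) (p : h.idem) :
    IsIdempotentElem (D.diag (p : S0)) :=
  (hm.isIdempotentElem_iff _).2 p.2

/-- `W⁰ = {(x⁺, x, x*)}`. -/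
def diagSub (hm : D.IsTwistedMul) (h2 : D.Cond2) : Subsemigroup D.W where
  carrier := Set.range D.diag
  mul_mem' := by
    rintro _ _ ⟨x, rfl⟩ ⟨y, rfl⟩
    exact ⟨_, (hm.diag_mul h2 x y).symm⟩

/-- `x ↦ (x⁺, x, x*)` as an isomorphism onto `W⁰`. -/
noncomputable def diagEquiv (hm : D.IsTwistedMul) (h2 : D.Cond2) : S0 ≃* hm.diagSub h2 where
  toFun x := ⟨D.diag x, x, rfl⟩
  invFun w := (w : D.W).x
  left_inv _ := rfl
  right_inv := by
    rintro ⟨_, x, rfl⟩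
    rfl
  map_mul' x y := Subtype.ext (hm.diag_mul h2 x y).symm

theorem diag_mem (hm : D.IsTwistedMul) (h2 : D.Cond2) (x : S0) : D.diag x ∈ hm.diagSub h2 := ⟨x, rfl⟩

theorem isStarSubsemigroup (hm : D.IsTwistedMul) (h2 : D.Cond2) (h3 : D.Cond3) (h4 : D.Cond4) :
    IsStarSubsemigroup (hm.diagSub h2) := by
  apply isStarSubsemigroup_of_exists
  · rintro ⟨_, x, rfl⟩
    refine ⟨⟨D.diag (h.plus x : S0), hm.diag_mem h2 _⟩, Subtype.ext ?_, ?_⟩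
    · exact hm.isIdempotentElem_diag _
    · exact hm.rstar_diag_plus h3 x
  · rintro ⟨_, x, rfl⟩
    refine ⟨⟨D.diag (h.ast x : S0), hm.diag_mem h2 _⟩, Subtype.ext ?_, ?_⟩
    · exact hm.isIdempotentElem_diag _
    · exact hm.lstar_diag_ast h4 x

theorem isAdequate_diagSub (hm : D.IsTwistedMul) (h2 : D.Cond2) (h3 : D.Cond3) (h4 : D.Cond4) : IsAdequate (hm.diagSub h2) where
  toIsAbundant := (hm.isStarSubsemigroup h2 h3 h4).abundant
  comm := by
    rintro ⟨_, x, rfl⟩ ⟨_, y, rfl⟩ hx hy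
    have hx' := (hm.isIdempotentElem_iff _).1 (congrArg Subtype.val hx)
    have hy' := (hm.isIdempotentElem_iff _).1 (congrArg Subtype.val hy)
    apply Subtype.ext
    change D.diag x * D.diag y = D.diag y * D.diag x
    rw [hm.diag_mul h2, hm.diag_mul h2, h.comm x y hx' hy']

theorem plus_diag (hm : D.IsTwistedMul) (h2 : D.Cond2) (h3 : D.Cond3) (H : IsAdequate (hm.diagSub h2)) (x : S0) :
    ((H.plus ⟨D.diag x, hm.diag_mem h2 x⟩ : hm.diagSub h2) : D.W) = D.diag (h.plus x : S0) := by
  rw [← H.eq_plus (e := ⟨D.diag (h.plus x : S0), hm.diag_mem h2 _⟩)]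
  · exact Subtype.ext (hm.isIdempotentElem_diag _)
  · exact rstar_coe (hm.rstar_diag_plus h3 x)

theorem ast_diag (hm : D.IsTwistedMul) (h2 : D.Cond2) (h4 : D.Cond4) (H : IsAdequate (hm.diagSub h2)) (x : S0) :
    ((H.ast ⟨D.diag x, hm.diag_mem h2 x⟩ : hm.diagSub h2) : D.W) = D.diag (h.ast x : S0) := by
  rw [← H.eq_ast (e := ⟨D.diag (h.ast x : S0), hm.diag_mem h2 _⟩)]
  · exact Subtype.ext (hm.isIdempotentElem_diag _)
  · exact lstar_coe (hm.lstar_diag_ast h4 x)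

theorem eq_leftProj_mul_diag_mul_rightProj (hm : D.IsTwistedMul) (w : D.W) :
    w = D.leftProj w * D.diag w.x * D.rightProj w := by
  have h1 : (h.plus w.x : S0) * w.x = w.x := h.plus_mul _
  have h2 : w.x * (h.ast w.x : S0) = w.x := h.mul_ast _
  have hx : (D.leftProj w * D.diag w.x).x = w.x := (hm.mul_x _ _).trans h1
  apply W.ext
  · rw [hm.mul_e_of_plus _ _ (by rw [hx, rightProj_x, h2]), hm.mul_e_of_plus]
    · rfl
    · rw [← hm.mul_x, hx, leftProj_x, h.plus_coe]
  · rw [hm.mul_x, hx]; exact h2.symm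
  · rw [hm.mul_f_of_ast _ _ (by rw [hx, rightProj_x, h2, h.ast_coe])]; rfl

theorem leftProj_mul_diag (hm : D.IsTwistedMul) (w : D.W) : D.leftProj w * D.diag (h.plus w.x : S0) = D.leftProj w := by
  have hp : (h.plus w.x : S0) * (h.plus w.x : S0) = (h.plus w.x : S0) := (h.plus w.x).2
  apply W.ext
  · exact hm.mul_e_of_plus _ _ (congrArg h.plus hp)
  · exact (hm.mul_x _ _).trans hp
  · exact (hm.mul_f_of_ast _ _ (congrArg h.ast hp)).trans (congrArg D.toΛ (h.ast_coe _))

theorem diag_mul_leftProj (hm : D.IsTwistedMul) (w : D.W) :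
    D.diag (h.plus w.x : S0) * D.leftProj w = D.diag (h.plus w.x : S0) := by
  have hp : (h.plus w.x : S0) * (h.plus w.x : S0) = (h.plus w.x : S0) := (h.plus w.x).2
  apply W.ext
  · exact hm.mul_e_of_plus _ _ (congrArg h.plus hp)
  · exact (hm.mul_x _ _).trans hp
  · exact (hm.mul_f_of_ast _ _ (congrArg h.ast hp)).trans (congrArg D.toΛ (h.ast_coe _).symm)

theorem rightProj_mul_diag (hm : D.IsTwistedMul) (w : D.W) :
    D.rightProj w * D.diag (h.ast w.x : S0) = D.diag (h.ast w.x : S0) := by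
  have hp : (h.ast w.x : S0) * (h.ast w.x : S0) = (h.ast w.x : S0) := (h.ast w.x).2
  apply W.ext
  · exact (hm.mul_e_of_plus _ _ (congrArg h.plus hp)).trans (congrArg D.toI (h.plus_coe _).symm)
  · exact (hm.mul_x _ _).trans hp
  · exact hm.mul_f_of_ast _ _ (congrArg h.ast hp)

theorem diag_mul_rightProj (hm : D.IsTwistedMul) (w : D.W) :
    D.diag (h.ast w.x : S0) * D.rightProj w = D.rightProj w := by
  have hp : (h.ast w.x : S0) * (h.ast w.x : S0) = (h.ast w.x : S0) := (h.ast w.x).2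
  apply W.ext
  · exact (hm.mul_e_of_plus _ _ (congrArg h.plus hp)).trans (congrArg D.toI (h.plus_coe _))
  · exact (hm.mul_x _ _).trans hp
  · exact hm.mul_f_of_ast _ _ (congrArg h.ast hp)

theorem decomposes (hm : D.IsTwistedMul) (h2 : D.Cond2) (h3 : D.Cond3) (h4 : D.Cond4) (H : IsAdequate (hm.diagSub h2)) (w : D.W) :
    Decomposes H w (D.leftProj w) ⟨D.diag w.x, hm.diag_mem h2 w.x⟩ (D.rightProj w) := by
  refine .of_mul (hm.isIdempotentElem_leftProj w) (hm.isIdempotentElem_rightProj w)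
    (hm.eq_leftProj_mul_diag_mul_rightProj w) ?_ ?_ ?_ ?_ <;>
  simp only [hm.plus_diag h2 h3 H, hm.ast_diag h2 h4 H]
  · exact hm.leftProj_mul_diag w
  · exact hm.diag_mul_leftProj w
  · exact hm.rightProj_mul_diag w
  · exact hm.diag_mul_rightProj w

/-- The middle factor in a decomposition of `w` is `(x⁺, x, x*)`, `x` being the second component
of `w`. -/
theorem x_eq_of_decomposes (hm : D.IsTwistedMul) (h2 : D.Cond2) (h3 : D.Cond3) (h4 : D.Cond4) (H : IsAdequate (hm.diagSub h2))
    {w a b : D.W} {y : S0} (d : Decomposes H w a ⟨D.diag y, hm.diag_mem h2 y⟩ b) : w.x = y := by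
  have l1 := d.mul_plus
  have l2 := d.plus_mul
  have r1 := d.mul_ast
  have r2 := d.ast_mul
  rw [hm.plus_diag h2 h3 H] at l1 l2
  rw [hm.ast_diag h2 h4 H] at r1 r2
  replace l1 := congrArg W.x l1
  replace l2 := congrArg W.x l2
  replace r1 := congrArg W.x r1
  replace r2 := congrArg W.x r2
  rw [hm.mul_x] at l1 l2 r1 r2
  have ha := (hm.isIdempotentElem_iff _).1 d.idem_left
  have hb := (hm.isIdempotentElem_iff _).1 d.idem_right
  -- Commuting idempotents of `S⁰` that are `ℒ`-related are equal, so the middle entry of `a` has to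
  -- be `y⁺`.
  have ha' : a.x = (h.plus y : S0) := by
    rw [← l1]; exact (h.comm _ _ ha (h.plus y).2).trans l2
  have hb' : b.x = (h.ast y : S0) := by
    rw [← r2]; exact (h.comm _ _ (h.ast y).2 hb).trans r1
  rw [d.eq, hm.mul_x, hm.mul_x, ha', hb']
  change (h.plus y : S0) * y * (h.ast y : S0) = y
  rw [h.plus_mul, h.mul_ast]

theorem isAdequateTransversal (hm : D.IsTwistedMul) (h2 : D.Cond2) (h3 : D.Cond3) (h4 : D.Cond4) :
    IsAdequateTransversal (hm.diagSub h2) where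
  abundant := (hm.isQuasiAdequate h3 h4).toIsAbundant
  adequate := hm.isAdequate_diagSub h2 h3 h4
  starSub := hm.isStarSubsemigroup h2 h3 h4
  existsUnique_bar w := by
    refine ⟨_, ⟨_, _, hm.decomposes h2 h3 h4 _ w⟩, ?_⟩
    rintro ⟨_, y, rfl⟩ ⟨a, b, d⟩
    have := hm.x_eq_of_decomposes h2 h3 h4 _ d
    exact Subtype.ext (congrArg D.diag this.symm)

theorem bar_eq (hm : D.IsTwistedMul) (h2 : D.Cond2) (h3 : D.Cond3) (h4 : D.Cond4) (hT : IsAdequateTransversal (hm.diagSub h2))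
    (w : D.W) : hT.bar w = ⟨D.diag w.x, hm.diag_mem h2 w.x⟩ :=
  (hm.decomposes h2 h3 h4 hT.adequate w).bar_eq

theorem admissible (hm : D.IsTwistedMul) (h2 : D.Cond2) (h3 : D.Cond3) (h4 : D.Cond4) (hT : IsAdequateTransversal (hm.diagSub h2)) :
    hT.Admissible := by
  intro a b
  rw [hm.bar_eq h2 h3 h4, hm.bar_eq h2 h3 h4, hm.bar_eq h2 h3 h4]
  exact Subtype.ext ((congrArg D.diag (hm.mul_x a b)).trans (hm.diag_mul h2 _ _).symm)

theorem leftFactors_eq (hm : D.IsTwistedMul) (h2 : D.Cond2) (h3 : D.Cond3) (h4 : D.Cond4) (hT : IsAdequateTransversal (hm.diagSub h2)) :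
    hT.leftFactors = Set.range D.leftProj := by
  ext a
  constructor
  · rintro ⟨x, f, d⟩
    rw [hm.bar_eq h2 h3 h4] at d
    exact ⟨x, (hT.decomposes_unique (hm.decomposes h2 h3 h4 _ x) d).1⟩
  · rintro ⟨w, rfl⟩
    refine ⟨w, D.rightProj w, ?_⟩
    rw [hm.bar_eq h2 h3 h4]
    exact hm.decomposes h2 h3 h4 _ w

theorem rightFactors_eq (hm : D.IsTwistedMul) (h2 : D.Cond2) (h3 : D.Cond3) (h4 : D.Cond4)
    (hT : IsAdequateTransversal (hm.diagSub h2)) :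
    hT.rightFactors = Set.range D.rightProj := by
  ext a
  constructor
  · rintro ⟨x, f, d⟩
    rw [hm.bar_eq h2 h3 h4] at d
    exact ⟨x, (hT.decomposes_unique (hm.decomposes h2 h3 h4 _ x) d).2.2⟩
  · rintro ⟨w, rfl⟩
    refine ⟨w, D.leftProj w, ?_⟩
    rw [hm.bar_eq h2 h3 h4]
    exact hm.decomposes h2 h3 h4 _ w

end IsTwistedMul

/-! ### Condition (5): recovering `I` and `Λ` from `W` -/

theorem leftProj_mul_leftProj_e (hm : D.IsTwistedMul) (h5 : D.Cond5) (a b : D.W) :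
    (D.leftProj a * D.leftProj b).e = a.e * b.e := by
  -- The third entry of the left projection of `a` is `x⁺` itself, so here `f = f⁰ = x⁺` and `α`
  -- takes the value `x⁺ e`.
  have key := (h5 (D.toΛ (h.plus a.x)) b.e).1
  rw [zero_I_eq b.e_mem, zero_Λ_eq (D.toΛ_mem _)] at key
  rw [(hm _ _).1]
  change a.e * D.α (h.plus a.x) (h.plus b.x) (D.toΛ (h.plus a.x)) b.e = _
  rw [key, ← mul_assoc, (mem_Lcl.1 a.e_mem).1]

theorem rightProj_mul_rightProj_f (hm : D.IsTwistedMul) (h5 : D.Cond5) (a b : D.W) :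
    (D.rightProj a * D.rightProj b).f = a.f * b.f := by
  have key := (h5 a.f (D.toI (h.ast b.x))).2
  rw [zero_Λ_eq a.f_mem, zero_I_eq (D.toI_mem _)] at key
  rw [(hm _ _).2.2]
  change D.β (h.ast a.x) (h.ast b.x) a.f (D.toI (h.ast b.x)) * b.f = _
  rw [key, mul_assoc, (mem_Rcl.1 b.f_mem).2]

theorem nonempty_equiv_of_coe_eq_range_leftProj (hm : D.IsTwistedMul) (h5 : D.Cond5)
    (K : Subsemigroup D.W) (hK : (K : Set D.W) = Set.range D.leftProj) : Nonempty (K ≃* I) := by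
  have mem : ∀ a : D.W, a ∈ K ↔ a ∈ Set.range D.leftProj := fun a => by
    rw [← hK]; rfl
  let φ : K →ₙ* I :=
    { toFun := fun a => (a : D.W).e
      map_mul' := by
        rintro ⟨a, ha⟩ ⟨b, hb⟩
        obtain ⟨a, rfl⟩ := (mem _).1 ha
        obtain ⟨b, rfl⟩ := (mem _).1 hb
        exact leftProj_mul_leftProj_e hm h5 a b }
  refine ⟨MulEquiv.ofBijective φ ⟨?_, fun e => ?_⟩⟩
  · rintro ⟨a, ha⟩ ⟨b, hb⟩ hab
    obtain ⟨a, rfl⟩ := (mem _).1 ha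
    obtain ⟨b, rfl⟩ := (mem _).1 hb
    exact Subtype.ext (leftProj_eq_of_e hab)
  -- Every `e` is attained, at the triple `(e, e⁰, e⁰)`.
  · let w : D.W := ⟨e, (D.transI.zero e : S0), D.toΛ (D.transI.zero e),
      by rw [h.plus_coe]; exact zero_I_mem e, by rw [h.ast_coe]; exact D.toΛ_mem _⟩
    exact ⟨⟨D.leftProj w, (mem _).2 ⟨w, rfl⟩⟩, rfl⟩

theorem nonempty_equiv_of_coe_eq_range_rightProj (hm : D.IsTwistedMul) (h5 : D.Cond5)
    (K : Subsemigroup D.W) (hK : (K : Set D.W) = Set.range D.rightProj) : Nonempty (K ≃* Λ) := by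
  have mem : ∀ a : D.W, a ∈ K ↔ a ∈ Set.range D.rightProj := fun a => by
    rw [← hK]; rfl
  let φ : K →ₙ* Λ :=
    { toFun := fun a => (a : D.W).f
      map_mul' := by
        rintro ⟨a, ha⟩ ⟨b, hb⟩
        obtain ⟨a, rfl⟩ := (mem _).1 ha
        obtain ⟨b, rfl⟩ := (mem _).1 hb
        exact rightProj_mul_rightProj_f hm h5 a b }
  refine ⟨MulEquiv.ofBijective φ ⟨?_, fun f => ?_⟩⟩
  · rintro ⟨a, ha⟩ ⟨b, hb⟩ hab
    obtain ⟨a, rfl⟩ := (mem _).1 ha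
    obtain ⟨b, rfl⟩ := (mem _).1 hb
    exact Subtype.ext (rightProj_eq_of_f hab)
  · let w : D.W := ⟨D.toI (D.transΛ.zero f), (D.transΛ.zero f : S0), f,
      by rw [h.plus_coe]; exact D.toI_mem _, by rw [h.ast_coe]; exact zero_Λ_mem f⟩
    exact ⟨⟨D.rightProj w, (mem _).2 ⟨w, rfl⟩⟩, rfl⟩

end TwistedData

/-! ### Twisted data extracted from an admissible transversal -/

namespace IsAdequateTransversal

variable {S : Type*} [Semigroup S] {S0 : Subsemigroup S} (hT : IsAdequateTransversal S0)

/-- The left factor `e_x`. -/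
noncomputable def leftFactor (x : S) : S := (hT.exists_decomposes x).choose

/-- The right factor `f_x`. -/
noncomputable def rightFactor (x : S) : S := (hT.exists_decomposes x).choose_spec.choose

theorem decomposes_factor (x : S) :
    Decomposes hT.adequate x (hT.leftFactor x) (hT.bar x) (hT.rightFactor x) :=
  (hT.exists_decomposes x).choose_spec.choose_spec

theorem _root_.AdequateTransversal.Decomposes.leftFactor_eq {hT : IsAdequateTransversal S0}
    {x e f : S} {s : S0} (d : Decomposes hT.adequate x e s f) : hT.leftFactor x = e :=
  (hT.decomposes_unique (hT.decomposes_factor x) d).1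

theorem _root_.AdequateTransversal.Decomposes.rightFactor_eq {hT : IsAdequateTransversal S0}
    {x e f : S} {s : S0} (d : Decomposes hT.adequate x e s f) : hT.rightFactor x = f :=
  (hT.decomposes_unique (hT.decomposes_factor x) d).2.2

theorem idem_mem_leftFactors (p : hT.adequate.idem) : ((p : S0) : S) ∈ hT.leftFactors :=
  hT.mem_leftFactors.2 ⟨idem_coe_coe p, p, idem_coe_coe p, idem_coe_coe p⟩

theorem idem_mem_rightFactors (p : hT.adequate.idem) : ((p : S0) : S) ∈ hT.rightFactors :=
  hT.mem_rightFactors.2 ⟨idem_coe_coe p, p, idem_coe_coe p, idem_coe_coe p⟩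

/-- For `f ℛ x*` and `g ℒ y⁺` the element `x f g y` has middle factor `x y`. -/
theorem decomposes_mul_mul_mul (hA : hT.Admissible) {x y : S0} {f g : S}
    (hf : IsIdempotentElem f) (hg : IsIdempotentElem g)
    (hf1 : f * ((hT.adequate.ast x : S0) : S) = ((hT.adequate.ast x : S0) : S))
    (hf2 : ((hT.adequate.ast x : S0) : S) * f = f)
    (hg1 : g * ((hT.adequate.plus y : S0) : S) = g)
    (hg2 : ((hT.adequate.plus y : S0) : S) * g = ((hT.adequate.plus y : S0) : S)) :
    Decomposes hT.adequate (x * f * g * y) (hT.leftFactor (x * f * g * y)) (x * y)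
      (hT.rightFactor (x * f * g * y)) := by
  have key : hT.bar (x * f * g * y) = x * y := by
    rw [hA, hA, hA, (Decomposes.coe hT.adequate x).bar_eq, (Decomposes.coe hT.adequate y).bar_eq,
      (Decomposes.of_right hf hf1 hf2).bar_eq, (Decomposes.of_left hg hg1 hg2).bar_eq,
      hT.adequate.mul_ast, mul_assoc, hT.adequate.plus_mul]
  have := hT.decomposes_factor (x * f * g * y)
  rwa [key] at this

/-- Since `ab` is `ℒ`-related to `qp` and `p a = p`, one has `aba = (ab)qpa = (ab)qp = ab`. -/
theorem isLeftRegularBand (hS : IsQuasiAdequate S) (hA : hT.Admissible) :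
    IsLeftRegularBand (hT.leftSub hS hA) where
  idem a := Subtype.ext (hT.mem_leftFactors.1 a.2).1
  left_regular := by
    rintro ⟨a, ha⟩ ⟨b, hb⟩
    obtain ⟨ha, p, h1, h2⟩ := hT.mem_leftFactors.1 ha
    obtain ⟨hb, q, h3, h4⟩ := hT.mem_leftFactors.1 hb
    have key := (hT.mul_leftFactors hA ha hb h1 h2 h3 h4).1
    rw [hT.adequate.idem_comm] at key
    have hpq : (((q * p : hT.adequate.idem) : S0) : S) = ((q : S0) : S) * ((p : S0) : S) := rfl
    apply Subtype.ext
    change a * b * a = a * b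
    rw [← key, hpq, mul_assoc, mul_assoc _ _ a, h2]

theorem isRightRegularBand (hS : IsQuasiAdequate S) (hA : hT.Admissible) :
    IsRightRegularBand (hT.rightSub hS hA) where
  idem a := Subtype.ext (hT.mem_rightFactors.1 a.2).1
  right_regular := by
    rintro ⟨a, ha⟩ ⟨b, hb⟩
    obtain ⟨ha, p, h1, h2⟩ := hT.mem_rightFactors.1 ha
    obtain ⟨hb, q, h3, h4⟩ := hT.mem_rightFactors.1 hb
    have key := (hT.mul_rightFactors hA hb ha h3 h4 h1 h2).2
    rw [hT.adequate.idem_comm] at key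
    have hpq : (((p * q : hT.adequate.idem) : S0) : S) = ((p : S0) : S) * ((q : S0) : S) := rfl
    apply Subtype.ext
    change a * b * a = b * a
    rw [mul_assoc, ← key, hpq, ← mul_assoc a, ← mul_assoc a, h1]

/-- The embedding of `E⁰` in `I(S)`. -/
def idemToLeft (hS : IsQuasiAdequate S) (hA : hT.Admissible) :
    hT.adequate.idem →ₙ* hT.leftSub hS hA where
  toFun p := ⟨((p : S0) : S), hT.idem_mem_leftFactors p⟩
  map_mul' _ _ := rfl

/-- The embedding of `E⁰` in `Λ(S)`. -/
def idemToRight (hS : IsQuasiAdequate S) (hA : hT.Admissible) :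
    hT.adequate.idem →ₙ* hT.rightSub hS hA where
  toFun p := ⟨((p : S0) : S), hT.idem_mem_rightFactors p⟩
  map_mul' _ _ := rfl

theorem isSemilatticeTransversal_left (hS : IsQuasiAdequate S) (hA : hT.Admissible) :
    IsSemilatticeTransversal (hT.idemToLeft hS hA) where
  injective _ _ hpq :=
    Subtype.ext (Subtype.ext (congrArg (fun a : hT.leftSub hS hA => (a : S)) hpq))
  existsUnique_inverse := by
    rintro ⟨a, ha⟩
    obtain ⟨ha', p, h1, h2⟩ := hT.mem_leftFactors.1 ha
    refine ⟨p, ⟨Subtype.ext ?_, Subtype.ext ?_⟩, fun q hq => ?_⟩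
    · change a * p * a = a
      rw [h1, ha'.eq]
    · change (p : S0) * a * p = ((p : S0) : S)
      rw [h2, (idem_coe_coe p).eq]
    -- Any inverse `q` of `a` in `E⁰` yields a decomposition `a = a q q`, so `q` is the middle term
    -- of `a` and is unique.
    · have hq' := (hT.isLeftRegularBand hS hA).mul_eq_of_isInverse hq
      exact (Decomposes.of_left ha' (congrArg Subtype.val hq'.1)
        (congrArg Subtype.val hq'.2)).bar_eq (hT := hT) |>.symm.trans
          (Decomposes.of_left ha' h1 h2).bar_eq |> Subtype.ext

theorem isSemilatticeTransversal_right (hS : IsQuasiAdequate S) (hA : hT.Admissible) :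
    IsSemilatticeTransversal (hT.idemToRight hS hA) where
  injective _ _ hpq :=
    Subtype.ext (Subtype.ext (congrArg (fun a : hT.rightSub hS hA => (a : S)) hpq))
  existsUnique_inverse := by
    rintro ⟨a, ha⟩
    obtain ⟨ha', p, h1, h2⟩ := hT.mem_rightFactors.1 ha
    refine ⟨p, ⟨Subtype.ext ?_, Subtype.ext ?_⟩, fun q hq => ?_⟩
    · change a * p * a = a
      rw [h1, h2]
    · change (p : S0) * a * p = ((p : S0) : S)
      rw [h2, h1]
    · have hq' := (hT.isRightRegularBand hS hA).mul_eq_of_isInverse hq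
      exact (Decomposes.of_right ha' (congrArg Subtype.val hq'.1)
        (congrArg Subtype.val hq'.2)).bar_eq (hT := hT) |>.symm.trans
          (Decomposes.of_right ha' h1 h2).bar_eq |> Subtype.ext

variable {hT}

theorem coe_mul_of_greenL {hS : IsQuasiAdequate S} {hA : hT.Admissible} {p : hT.adequate.idem}
    {g : hT.leftSub hS hA} (hg : GreenL g (hT.idemToLeft hS hA p)) :
    (g : S) * ((p : S0) : S) = g ∧ ((p : S0) : S) * g = ((p : S0) : S) :=
  have hB := hT.isLeftRegularBand hS hA
  ⟨congrArg Subtype.val (hg.mul_left_eq (hB.idem _)),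
    congrArg Subtype.val (hg.symm.mul_left_eq (hB.idem _))⟩

theorem coe_mul_of_greenR {hS : IsQuasiAdequate S} {hA : hT.Admissible} {p : hT.adequate.idem}
    {f : hT.rightSub hS hA} (hf : GreenR f (hT.idemToRight hS hA p)) :
    (f : S) * ((p : S0) : S) = ((p : S0) : S) ∧ ((p : S0) : S) * f = f :=
  have hB := hT.isRightRegularBand hS hA
  ⟨congrArg Subtype.val (hf.symm.mul_right_eq (hB.idem _)),
    congrArg Subtype.val (hf.mul_right_eq (hB.idem _))⟩

theorem idem_left {hS : IsQuasiAdequate S} {hA : hT.Admissible} (g : hT.leftSub hS hA) :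
    IsIdempotentElem (g : S) := (hT.mem_leftFactors.1 g.2).1

theorem idem_right {hS : IsQuasiAdequate S} {hA : hT.Admissible} (f : hT.rightSub hS hA) :
    IsIdempotentElem (f : S) := (hT.mem_rightFactors.1 f.2).1

theorem decomposes_of_green {hS : IsQuasiAdequate S} {hA : hT.Admissible} {x y : S0}
    {f : hT.rightSub hS hA} {g : hT.leftSub hS hA}
    (hf : GreenR f (hT.idemToRight hS hA (hT.adequate.ast x)))
    (hg : GreenL g (hT.idemToLeft hS hA (hT.adequate.plus y))) :
    Decomposes hT.adequate (x * f * g * y) (hT.leftFactor (x * f * g * y)) (x * y)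
      (hT.rightFactor (x * f * g * y)) :=
  hT.decomposes_mul_mul_mul hA (idem_right f) (idem_left g) (coe_mul_of_greenR hf).1
    (coe_mul_of_greenR hf).2 (coe_mul_of_greenL hg).1 (coe_mul_of_greenL hg).2

variable (hT)

/-- The data attached to `S`: `(f, g)α_{x,y} = e_{xfgy}` and `(f, g)β_{x,y} = f_{xfgy}`. -/
noncomputable def twistedData (hS : IsQuasiAdequate S) (hA : hT.Admissible) :
    TwistedData hT.adequate (hT.leftSub hS hA) (hT.rightSub hS hA) where
  leftRegular := hT.isLeftRegularBand hS hA
  rightRegular := hT.isRightRegularBand hS hA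
  toI := hT.idemToLeft hS hA
  toΛ := hT.idemToRight hS hA
  transI := hT.isSemilatticeTransversal_left hS hA
  transΛ := hT.isSemilatticeTransversal_right hS hA
  α x y f g := ⟨hT.leftFactor (x * f * g * y), _, _, hT.decomposes_factor _⟩
  β x y f g := ⟨hT.rightFactor (x * f * g * y), _, _, hT.decomposes_factor _⟩
  α_mem x y f g hf hg := by
    have d := decomposes_of_green hf hg
    exact greenL_of_mul (Subtype.ext d.mul_plus) (Subtype.ext d.plus_mul)
  β_mem x y f g hf hg := by
    have d := decomposes_of_green hf hg
    exact greenR_of_mul (Subtype.ext d.mul_ast) (Subtype.ext d.ast_mul)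

section

variable {hT} {hS : IsQuasiAdequate S} {hA : hT.Admissible}

theorem mul_of_mem_Lcl {g : hT.leftSub hS hA} {p : hT.adequate.idem}
    (hg : g ∈ (hT.twistedData hS hA).Lcl p) :
    (g : S) * ((p : S0) : S) = g ∧ ((p : S0) : S) * g = ((p : S0) : S) := coe_mul_of_greenL hg

theorem mul_of_mem_Rcl {f : hT.rightSub hS hA} {p : hT.adequate.idem}
    (hf : f ∈ (hT.twistedData hS hA).Rcl p) :
    (f : S) * ((p : S0) : S) = ((p : S0) : S) ∧ ((p : S0) : S) * f = f := coe_mul_of_greenR hf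

theorem decomposes_αβ {x y : S0} {f : hT.rightSub hS hA} {g : hT.leftSub hS hA}
    (hf : f ∈ (hT.twistedData hS hA).Rcl (hT.adequate.ast x))
    (hg : g ∈ (hT.twistedData hS hA).Lcl (hT.adequate.plus y)) :
    Decomposes hT.adequate (x * f * g * y) ((hT.twistedData hS hA).α x y f g : S) (x * y)
      ((hT.twistedData hS hA).β x y f g : S) := decomposes_of_green hf hg

/-- The link between the two multiplications: the terms of `(e x f)(g y k)` are the entries of `(e,
x, f)(g, y, k)`. -/
theorem decomposes_αβ_mul {x y : S0} {f k : hT.rightSub hS hA} {e g : hT.leftSub hS hA}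
    (he : e ∈ (hT.twistedData hS hA).Lcl (hT.adequate.plus x))
    (hf : f ∈ (hT.twistedData hS hA).Rcl (hT.adequate.ast x))
    (hg : g ∈ (hT.twistedData hS hA).Lcl (hT.adequate.plus y))
    (hk : k ∈ (hT.twistedData hS hA).Rcl (hT.adequate.ast y)) :
    Decomposes hT.adequate (e * (x * f * g * y) * k)
      (e * (hT.twistedData hS hA).α x y f g : S) (x * y)
      ((hT.twistedData hS hA).β x y f g * k : S) :=
  ((decomposes_αβ hf hg).mul_left hS (idem_left e) (mul_of_mem_Lcl he).2
    (hT.adequate.plus_mul_mul_plus x y)).mul_right hS (idem_right k) (mul_of_mem_Rcl hk).1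
    (hT.adequate.ast_mul_ast_mul x y)

theorem twistedData_cond1 : (hT.twistedData hS hA).Cond1 := by
  intro x y z f hf g hg k hk l hl
  set D := hT.twistedData hS hA
  have hα := D.α_mem_Lcl hf hg
  have hβ := D.β_mem_Rcl hf hg
  have hα' := D.α_mem_Lcl hk hl
  have hβ' := D.β_mem_Rcl hk hl
  have d1 := (decomposes_αβ (TwistedData.mul_mem_Rcl hk hβ (hT.adequate.ast_mul_ast_mul _ _))
    hl).mul_left hS (idem_left (D.α x y f g)) (mul_of_mem_Lcl hα).2
    (hT.adequate.plus_mul_mul_plus _ _)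
  have d2 := (decomposes_αβ hf (TwistedData.mul_mem_Lcl hg hα'
    (hT.adequate.plus_mul_mul_plus _ _))).mul_right hS (idem_right (D.β y z k l))
    (mul_of_mem_Rcl hβ').1 (hT.adequate.ast_mul_ast_mul _ _)
  have e1 := (decomposes_αβ hf hg).eq
  have e2 := (decomposes_αβ hk hl).eq
  -- Both sides equal `x f g y k l z`, with `x f g y` factored on the left and `y k l z` on the
  -- right. Uniqueness then gives both identities of (1).
  have heq : ((D.α x y f g : S) * (((x * y : S0) : S) * ((D.β x y f g * k : hT.rightSub hS hA) : S)
      * l * z)) = (x * f * ((g * D.α y z k l : hT.leftSub hS hA) : S) * ((y * z : S0) : S)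
      * (D.β y z k l : S)) := by
    calc _ = ((D.α x y f g : S) * ((x * y : S0) : S) * (D.β x y f g : S)) * k * l * z := by
          simp only [MulMemClass.coe_mul, mul_assoc]
      _ = x * f * g * ((D.α y z k l : S) * ((y * z : S0) : S) * (D.β y z k l : S)) := by
          rw [← e1, ← e2]; simp only [mul_assoc]
      _ = _ := by simp only [MulMemClass.coe_mul, mul_assoc]
  rw [heq] at d1
  obtain ⟨k1, -, k3⟩ := hT.decomposes_unique d1 d2
  exact ⟨Subtype.ext k1, Subtype.ext k3.symm⟩

theorem twistedData_cond2 : (hT.twistedData hS hA).Cond2 := by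
  intro x y
  have d := decomposes_αβ ((hT.twistedData hS hA).toΛ_mem (hT.adequate.ast x))
    ((hT.twistedData hS hA).toI_mem (hT.adequate.plus y))
  have hx : (x : S) * ((hT.adequate.ast x : S0) : S) * ((hT.adequate.plus y : S0) : S) * y =
      ((x * y : S0) : S) := by
    rw [← MulMemClass.coe_mul, ← MulMemClass.coe_mul, ← MulMemClass.coe_mul,
      hT.adequate.mul_ast, mul_assoc, hT.adequate.plus_mul]
  change Decomposes _ ((x : S) * ((hT.adequate.ast x : S0) : S) *
    ((hT.adequate.plus y : S0) : S) * y) _ _ _ at d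
  rw [hx] at d
  obtain ⟨k1, -, k3⟩ := hT.decomposes_unique d (Decomposes.coe hT.adequate (x * y))
  exact ⟨Subtype.ext k1, Subtype.ext k3⟩

/-- The hypotheses say that `e₁ x₁ f₁ e x` and `e₂ x₂ f₂ e x` have the same three terms. They are
therefore equal, and `x` may be replaced by `x⁺` through `ℛ*`; the conclusion compares the terms of
the resulting element. -/
theorem twistedData_cond3 : (hT.twistedData hS hA).Cond3 := by
  intro x x₁ x₂ e₁ he₁ f₁ hf₁ e₂ he₂ f₂ hf₂ e he hE hX hF
  set D := hT.twistedData hS hA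
  have d₁ := decomposes_αβ_mul he₁ hf₁ he (D.toΛ_mem (hT.adequate.ast x))
  have d₂ := decomposes_αβ_mul he₂ hf₂ he (D.toΛ_mem (hT.adequate.ast x))
  have hx : (x : S) * (D.toΛ (hT.adequate.ast x) : S) = x :=
    congrArg Subtype.val (hT.adequate.mul_ast x)
  have key : (e₁ : S) * (x₁ * f₁ * e * x) * (D.toΛ (hT.adequate.ast x) : S) =
      (e₂ : S) * (x₂ * f₂ * e * x) * (D.toΛ (hT.adequate.ast x) : S) := by
    rw [d₁.eq, d₂.eq, hX]
    congr 1
    · congr 1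
      exact congrArg Subtype.val hE
    · exact congrArg Subtype.val hF
  have key' : ((e₁ : S) * (x₁ * f₁ * e)) * x = ((e₂ : S) * (x₂ * f₂ * e)) * x := by
    have assoc : ∀ a b : S, a * (b * x) * (D.toΛ (hT.adequate.ast x) : S) = (a * b) * x := by
      intro a b
      rw [mul_assoc, mul_assoc b, hx, ← mul_assoc]
    rwa [assoc, assoc] at key
  have key2 := (hT.rstar_plus x).symm.mul_eq_mul key'
  rw [mul_assoc, mul_assoc (e₂ : S)] at key2
  -- The decomposition is now used with `x⁺` in place of `x`, which calls for `(x⁺)⁺ = x⁺`.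
  have he' : e ∈ D.Lcl (hT.adequate.plus (hT.adequate.plus x : S0)) := by
    rw [hT.adequate.plus_coe]; exact he
  have d₁' := (decomposes_αβ hf₁ he').mul_left hS (idem_left e₁) (mul_of_mem_Lcl he₁).2
    (hT.adequate.plus_mul_mul_plus _ _)
  have d₂' := (decomposes_αβ hf₂ he').mul_left hS (idem_left e₂) (mul_of_mem_Lcl he₂).2
    (hT.adequate.plus_mul_mul_plus _ _)
  rw [key2] at d₁'
  obtain ⟨k1, k2, k3⟩ := hT.decomposes_unique d₁' d₂'
  exact ⟨Subtype.ext k1, k2, Subtype.ext k3⟩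

theorem twistedData_cond4 : (hT.twistedData hS hA).Cond4 := by
  intro x x₁ x₂ e₁ he₁ f₁ hf₁ e₂ he₂ f₂ hf₂ f hf hE hX hF
  set D := hT.twistedData hS hA
  have d₁ := decomposes_αβ_mul (D.toI_mem (hT.adequate.plus x)) hf he₁ hf₁
  have d₂ := decomposes_αβ_mul (D.toI_mem (hT.adequate.plus x)) hf he₂ hf₂
  have hx : (D.toI (hT.adequate.plus x) : S) * x = x :=
    congrArg Subtype.val (hT.adequate.plus_mul x)
  have key : (D.toI (hT.adequate.plus x) : S) * (x * f * e₁ * x₁) * f₁ =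
      (D.toI (hT.adequate.plus x) : S) * (x * f * e₂ * x₂) * f₂ := by
    rw [d₁.eq, d₂.eq, hX]
    congr 1
    · congr 1
      exact congrArg Subtype.val hE
    · exact congrArg Subtype.val hF
  have key' : (x : S) * (f * e₁ * x₁ * f₁) = (x : S) * (f * e₂ * x₂ * f₂) := by
    have assoc : ∀ a b c : S, (D.toI (hT.adequate.plus x) : S) * (x * f * a * b) * c =
        x * (f * a * b * c) := by
      intro a b c
      simp only [← mul_assoc, hx]
    rwa [assoc, assoc] at key
  -- Dual cancellation: the leading `x` is replaced by `x*` through `ℒ*`.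
  have key2 := (hT.lstar_ast x).symm.mul_eq_mul key'
  simp only [← mul_assoc] at key2
  have hf' : f ∈ D.Rcl (hT.adequate.ast (hT.adequate.ast x : S0)) := by
    rw [hT.adequate.ast_coe]; exact hf
  have d₁' := (decomposes_αβ hf' he₁).mul_right hS (idem_right f₁) (mul_of_mem_Rcl hf₁).1
    (hT.adequate.ast_mul_ast_mul _ _)
  have d₂' := (decomposes_αβ hf' he₂).mul_right hS (idem_right f₂) (mul_of_mem_Rcl hf₂).1
    (hT.adequate.ast_mul_ast_mul _ _)
  rw [key2] at d₁'
  obtain ⟨k1, k2, k3⟩ := hT.decomposes_unique d₁' d₂'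
  exact ⟨Subtype.ext k1, k2, Subtype.ext k3⟩

theorem twistedData_cond5 : (hT.twistedData hS hA).Cond5 := by
  intro f e
  set D := hT.twistedData hS hA
  set p := D.transΛ.zero f
  set q := D.transI.zero e
  have hp := idem_coe_coe p
  have hq := idem_coe_coe q
  have hf := mul_of_mem_Rcl (TwistedData.zero_Λ_mem (D := D) f)
  have he := mul_of_mem_Lcl (TwistedData.zero_I_mem (D := D) e)
  constructor
  · apply Subtype.ext
    change hT.leftFactor (((p : S0) : S) * ((p : S0) : S) * e * ((q : S0) : S)) =
      ((p : S0) : S) * e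
    -- The element defining `α` is `p p e q = p e`, which lies in `I(S)` and is therefore its own
    -- left factor.
    rw [hp.eq, mul_assoc, he.1]
    obtain ⟨h0, r, h1, h2⟩ := hT.mem_leftFactors.1 (D.toI p * e).2
    exact (Decomposes.of_left h0 h1 h2).leftFactor_eq
  · apply Subtype.ext
    change hT.rightFactor (((p : S0) : S) * f * ((q : S0) : S) * ((q : S0) : S)) =
      f * ((q : S0) : S)
    rw [hf.2, mul_assoc, hq.eq]
    obtain ⟨h0, r, h1, h2⟩ := hT.mem_rightFactors.1 (f * D.toΛ q).2
    exact (Decomposes.of_right h0 h1 h2).rightFactor_eq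

theorem decomposes_W (w : (hT.twistedData hS hA).W) :
    Decomposes hT.adequate ((w.e : S) * w.x * w.f) w.e w.x w.f :=
  .of_mul (idem_left _) (idem_right _) rfl (mul_of_mem_Lcl w.e_mem).1 (mul_of_mem_Lcl w.e_mem).2
    (mul_of_mem_Rcl w.f_mem).1 (mul_of_mem_Rcl w.f_mem).2

/-- `(e, x, f) ↦ e x f` is an isomorphism of `W` onto `S`. -/
noncomputable def equivW [Semigroup (hT.twistedData hS hA).W]
    (hm : (hT.twistedData hS hA).IsTwistedMul) : S ≃* (hT.twistedData hS hA).W :=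
  MulEquiv.symm
  { toFun := fun w => (w.e : S) * w.x * w.f
    invFun := fun x =>
      { e := ⟨hT.leftFactor x, _, _, hT.decomposes_factor _⟩
        x := hT.bar x
        f := ⟨hT.rightFactor x, _, _, hT.decomposes_factor _⟩
        e_mem := greenL_of_mul (Subtype.ext (hT.decomposes_factor x).mul_plus)
          (Subtype.ext (hT.decomposes_factor x).plus_mul)
        f_mem := greenR_of_mul (Subtype.ext (hT.decomposes_factor x).mul_ast)
          (Subtype.ext (hT.decomposes_factor x).ast_mul) }
    left_inv := fun w => TwistedData.W.ext (Subtype.ext (decomposes_W w).leftFactor_eq)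
      ((decomposes_W w).bar_eq (hT := hT)) (Subtype.ext (decomposes_W w).rightFactor_eq)
    right_inv := fun x => (hT.decomposes_factor x).eq.symm
    map_mul' := fun a b => by
      -- Only the factorization equation of this decomposition is needed: it says that `(e, x, f) ↦
      -- e x f` respects products.
      have d := decomposes_αβ_mul a.e_mem a.f_mem b.e_mem b.f_mem
      change ((a * b).e : S) * (a * b).x * (a * b).f = (a.e * a.x * a.f) * (b.e * b.x * b.f)
      rw [(hm a b).1, (hm a b).2.1, (hm a b).2.2]
      refine d.eq.symm.trans ?_
      simp only [mul_assoc] }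

theorem decomposes_equivW [Semigroup (hT.twistedData hS hA).W]
    (hm : (hT.twistedData hS hA).IsTwistedMul) (x : S) :
    Decomposes hT.adequate x ((equivW hm x).e : S) (equivW hm x).x ((equivW hm x).f : S) :=
  hT.decomposes_factor x

theorem equivW_coe [Semigroup (hT.twistedData hS hA).W]
    (hm : (hT.twistedData hS hA).IsTwistedMul) (s : S0) :
    equivW hm (s : S) = (hT.twistedData hS hA).diag s :=
  have d := Decomposes.coe hT.adequate s
  TwistedData.W.ext (Subtype.ext (d.leftFactor_eq (hT := hT))) (d.bar_eq (hT := hT))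
    (Subtype.ext (d.rightFactor_eq (hT := hT)))

end

end IsAdequateTransversal

end AdequateTransversal

/-! ### Assembly of the two halves -/

theorem mainTheorem1 :
    (∀ (S0 : Type*) [Semigroup S0] (h : AdequateTransversal.IsAdequate S0)
        (I : Type*) [Semigroup I] (Λ : Type*) [Semigroup Λ]
        (D : AdequateTransversal.TwistedData h I Λ),
        D.Cond1 → D.Cond2 → D.Cond3 → D.Cond4 →
        ∃ _ : Semigroup D.W, D.IsTwistedMul ∧
          AdequateTransversal.IsQuasiAdequate D.W ∧
          ∃ W0 : Subsemigroup D.W, (W0 : Set D.W) = Set.range D.diag ∧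
            (∃ ψ : S0 ≃* W0, ∀ x : S0, (ψ x : D.W) = D.diag x) ∧
            ∃ hT : AdequateTransversal.IsAdequateTransversal W0, hT.Admissible ∧
              (D.Cond5 →
                (∃ K : Subsemigroup D.W, (K : Set D.W) = hT.leftFactors ∧ Nonempty (K ≃* I)) ∧
                (∃ K : Subsemigroup D.W, (K : Set D.W) = hT.rightFactors ∧ Nonempty (K ≃* Λ)))) ∧
    (∀ (S : Type*) [Semigroup S] (_ : AdequateTransversal.IsQuasiAdequate S)
        (S0 : Subsemigroup S) (hT : AdequateTransversal.IsAdequateTransversal S0),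
        hT.Admissible →
        ∃ I Λ : Subsemigroup S, (I : Set S) = hT.leftFactors ∧ (Λ : Set S) = hT.rightFactors ∧
          ∃ D : AdequateTransversal.TwistedData hT.adequate I Λ,
            (∀ p : hT.adequate.idem, (D.toI p : S) = ((p : S0) : S)) ∧
            (∀ p : hT.adequate.idem, (D.toΛ p : S) = ((p : S0) : S)) ∧
            D.Cond1 ∧ D.Cond2 ∧ D.Cond3 ∧ D.Cond4 ∧ D.Cond5 ∧
            ∃ _ : Semigroup D.W, D.IsTwistedMul ∧
              ∃ φ : S ≃* D.W,
                (∀ x : S, AdequateTransversal.Decomposes hT.adequate x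
                  ((φ x).e : S) (φ x).x ((φ x).f : S)) ∧
                (∀ s : S0, φ (s : S) = D.diag s)) := by
  constructor
  · intro S0 _ h I _ Λ _ D h1 h2 h3 h4
    let _ := D.semigroupW h1
    have hm : D.IsTwistedMul := D.semigroupW_isTwistedMul h1
    have hS := hm.isQuasiAdequate h3 h4
    have hT := hm.isAdequateTransversal h2 h3 h4
    have hA := hm.admissible h2 h3 h4 hT
    refine ⟨inferInstance, hm, hS, hm.diagSub h2, rfl, ⟨hm.diagEquiv h2, fun _ => rfl⟩, hT, hA,
      fun h5 => ⟨⟨hT.leftSub hS hA, rfl, ?_⟩, ⟨hT.rightSub hS hA, rfl, ?_⟩⟩⟩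
    · exact AdequateTransversal.TwistedData.nonempty_equiv_of_coe_eq_range_leftProj hm h5 _
        (hm.leftFactors_eq h2 h3 h4 hT)
    · exact AdequateTransversal.TwistedData.nonempty_equiv_of_coe_eq_range_rightProj hm h5 _
        (hm.rightFactors_eq h2 h3 h4 hT)
  · intro S _ hS S0 hT hA
    have h1 := AdequateTransversal.IsAdequateTransversal.twistedData_cond1 (hS := hS) (hA := hA)
    let _ := (hT.twistedData hS hA).semigroupW h1
    have hm : (hT.twistedData hS hA).IsTwistedMul :=
      (hT.twistedData hS hA).semigroupW_isTwistedMul h1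
    exact ⟨hT.leftSub hS hA, hT.rightSub hS hA, rfl, rfl, hT.twistedData hS hA, fun _ => rfl,
      fun _ => rfl, h1, AdequateTransversal.IsAdequateTransversal.twistedData_cond2,
      AdequateTransversal.IsAdequateTransversal.twistedData_cond3,
      AdequateTransversal.IsAdequateTransversal.twistedData_cond4,
      AdequateTransversal.IsAdequateTransversal.twistedData_cond5, inferInstance, hm,
      AdequateTransversal.IsAdequateTransversal.equivW hm,
      AdequateTransversal.IsAdequateTransversal.decomposes_equivW hm,
      AdequateTransversal.IsAdequateTransversal.equivW_coe hm⟩
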